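/- **Setting.** Let $n\ge 1$, $d\ge 0$, let $\phi:\mathbb R\to\mathbb R_+$ be convex, and let $\psi:\mathbb R^d\to\mathbb R_+$ be convex and decomposable, $\psi(w)=\sum_{j}\psi_j(w_j)$ with $\psi_j:\mathbb R\to\mathbb R$ convex. For labels $y\in\{\pm1\}^n$ and a matrix $X\in\mathbb R^{n\times d}$ put $Z=\mathrm{diag}(y)X$, with rows $z_{i\cdot}$ and columns $z_{\cdot j}$, and $$P(w)=\frac1n\sum_{i}\phi(z_{i\cdot}^\top w)+\psi(w),\qquad D(\alpha)=-\frac1n\sum_i\phi^*(-\alpha_i)-\psi^*\!\big(\tfrac1nZ^\top\alpha\big),\qquad \mathrm{dom}\,D=\{\alpha: D(\alpha)>-\infty\},$$ where $^*$ is the convex conjugate. Let $\hat X$ (old) and $\tilde X$ (new) be two matrices that agree outside a set $\mathcal M\subseteq[n]\times[d]$; hats and tildes mark the objects built from them. Let $\mathcal M_i$ and $\mathcal M_j$ be the sets of rows and of columns that contain an element of $\mathcal M$. Let $\hat w^*$ minimize $\hat P$ and $\hat\alpha^*$ maximize $\hat D$. Put $$\tilde G=\frac1n\sum_{i\in\mathcal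 M_i}\big(\phi(\tilde z_{i\cdot}^\top\hat w^*)-\phi(\hat z_{i\cdot}^\top\hat w^*)\big)+\sum_{j\in\mathcal M_j}\big(\psi_j^*(\tfrac1n\tilde z_{\cdot j}^\top\hat\alpha^*)-\psi_j^*(\tfrac1n\hat z_{\cdot j}^\top\hat\alpha^*)\big)\in(-\infty,+\infty].$$ **Bounds.** $\tilde G=\tilde P(\hat w^*)-\tilde D(\hat\alpha^*)$, and for every minimizer $\tilde w^*$ of $\tilde P$, every maximizer $\tilde\alpha^*$ of $\tilde D$, and all $j\in[d]$, $i\in[n]$ the following holds. (Here $\sqrt{+\infty}=+\infty$ and $0\cdot\infty=0$. The infimum of an empty subdifferential is read as $-\infty$ and the supremum as $+\infty$, i.e. as no bound; subdifferentials at $\pm\infty$ are empty.) (i) Suppose $\phi$ is $\gamma^{-1}$-smooth, $\gamma>0$ (differentiable with $\gamma^{-1}$-Lipschitz derivative). Then $L_D(\tilde w_j^*)\le\tilde w^*_j\le U_D(\tilde w_j^*)$ and $L_D(\tilde\alpha_i^*)\le\tilde\alpha_i^*\le U_D(\tilde\alpha_i^*)$, where $$L_D(\tilde w_j^*)=\inf\partial\psi_j^*\Big(\max\big\{\inf_{\alpha\in\mathrm{dom}\tilde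 D}\tfrac1n\tilde z_{\cdot j}^\top\alpha,\ \tfrac1n\tilde z_{\cdot j}^\top\hat\alpha^*-\|\tilde x_{\cdot j}\|_2\sqrt{2\gamma^{-1}\tilde G}\big\}\Big),$$ $$U_D(\tilde w_j^*)=\sup\partial\psi_j^*\Big(\min\big\{\sup_{\alpha\in\mathrm{dom}\tilde D}\tfrac1n\tilde z_{\cdot j}^\top\alpha,\ \tfrac1n\tilde z_{\cdot j}^\top\hat\alpha^*+\|\tilde x_{\cdot j}\|_2\sqrt{2\gamma^{-1}\tilde G}\big\}\Big),$$ $$L_D(\tilde\alpha_i^*)=\max\Big\{\inf_{\alpha\in\mathrm{dom}\tilde D}\alpha_i,\ \hat\alpha_i^*-\sqrt{2n\gamma^{-1}\tilde G}\Big\},\qquad U_D(\tilde\alpha_i^*)=\min\Big\{\sup_{\alpha\in\mathrm{dom}\tilde D}\alpha_i,\ \hat\alpha_i^*+\sqrt{2n\gamma^{-1}\tilde G}\Big\}.$$ (ii) Suppose $\psi$ is $\lambda$-strongly convex, $\lambda>0$ (subdifferentiable, and $\psi(a)\ge\psi(b)+g^\top(a-b)+\frac\lambda2\|a-b\|_2^2$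 for all $a,b$ and $g\in\partial\psi(b)$). Then $L_P(\tilde w_j^*)\le\tilde w^*_j\le U_P(\tilde w_j^*)$ and $L_P(\tilde\alpha_i^*)\le\tilde\alpha_i^*\le U_P(\tilde\alpha_i^*)$, where $$L_P(\tilde w_j^*)=\hat w_j^*-\sqrt{2\lambda^{-1}\tilde G},\qquad U_P(\tilde w_j^*)=\hat w_j^*+\sqrt{2\lambda^{-1}\tilde G},$$ $$L_P(\tilde\alpha_i^*)=\inf\Big(-\partial\phi\big(\tilde z_{i\cdot}^\top\hat w^*+\|\tilde x_{i\cdot}\|_2\sqrt{2\lambda^{-1}\tilde G}\big)\Big),\qquad U_P(\tilde\alpha_i^*)=\sup\Big(-\partial\phi\big(\tilde z_{i\cdot}^\top\hat w^*-\|\tilde x_{i\cdot}\|_2\sqrt{2\lambda^{-1}\tilde G}\big)\Big).$$ (iii) If both hold, then the bounds hold with $L_{PD}=\max\{L_P,L_D\}$ and $U_{PD}=\min\{U_P,U_D\}$, for $\tilde w_j^*$ and for $\tilde\alpha_i^*$. **Time.** Consider a random access machine over the extended reals. Arithmetic, $\max$, $\min$, square roots, comparisons, memory accesses, and evaluations of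 the scalar functions $\phi$, $\psi_j^*$, $\inf\partial\psi_j^*$, $\sup\partial\psi_j^*$, $\inf(-\partial\phi)$, $\sup(-\partial\phi)$ take one step each. It can read $n,\gamma,\lambda$, the two end points of $-\mathrm{dom}\,\phi^*$, the entries of $\hat X,\tilde X,y,\hat w^*,\hat\alpha^*$, a list of $\mathcal M$, and, stored for all $i$ and $j$ in arrays of total size $O(n+d)$, $$\hat z_{i\cdot}^\top\hat w^*,\quad\|\hat x_{i\cdot}\|_2,\quad\hat z_{\cdot j}^\top\hat\alpha^*,\quad\|\hat x_{\cdot j}\|_2,\quad\inf_{\alpha\in\mathrm{dom}\hat D}\tfrac1n\hat z_{\cdot j}^\top\alpha,\quad\sup_{\alpha\in\mathrm{dom}\hat D}\tfrac1n\hat z_{\cdot j}^\top\alpha .\qquad(*)$$ There are fixed programs and an absolute constant $C$, independent of the instance, such that after a first phase of at most $C(|\mathcal M|+1)$ steps the lower and the upper bound for any one index is evaluated in at most $C$ further steps. So each bound takes $O(|\mathcal M|)$ time (for $\mathcal M\neq\emptyset$). For the bounds of case (ii), $(*)$ is enough. The bounds of cases (i) and (iii) also use extremal values over $\mathrm{dom}\,\tilde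 D$. The claim holds for them if * the values $\inf/\sup_{\alpha\in\mathrm{dom}\tilde D}\tfrac1n\tilde z_{\cdot j}^\top\alpha$ and $\inf/\sup_{\alpha\in\mathrm{dom}\tilde D}\alpha_i$ that occur in them are stored too, or * only $(*)$ is stored and all $\psi_j^*$ are finite on $\mathbb R$ (so that $\mathrm{dom}\,D=(-\mathrm{dom}\,\phi^*)^n$ for all data) and, for the bounds on $\tilde w_j^*$, the two stored extrema for column $j$ in $(*)$ are finite. -/

import Mathlib

noncomputable section

namespace ERM

/-! ### Convex analysis -/

/-- Convex conjugate `f*(u) = sup_v (⟨u, v⟩ - f v)` of a real-valued function. -/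
def conj {E : Type*} [NormedAddCommGroup E] [InnerProductSpace ℝ E] (f : E → ℝ) (u : E) : EReal :=
  ⨆ v : E, ((inner ℝ u v - f v : ℝ) : EReal)

/-- Subdifferential `∂f(x)` of an extended-real-valued function. -/
def subdiff {E : Type*} [NormedAddCommGroup E] [InnerProductSpace ℝ E] (f : E → EReal) (x : E) :
    Set E :=
  {g | ∀ v : E, f x + ((inner ℝ g (v - x) : ℝ) : EReal) ≤ f v}

/-- Subdifferential of a function on the line at an extended real point: empty at `±∞`. -/
def subdiffAt (f : ℝ → EReal) (t : EReal) : Set ℝ :=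
  {g | ∃ r : ℝ, t = (r : EReal) ∧ g ∈ subdiff f r}

open Classical in
/-- The infimum of a set of reals used as a lower bound. An empty set gives no bound (`-∞`). -/
def infOf (S : Set ℝ) : EReal :=
  if S.Nonempty then sInf ((fun r : ℝ => (r : EReal)) '' S) else ⊥

open Classical in
/-- The supremum of a set of reals used as an upper bound. An empty set gives no bound (`+∞`). -/
def supOf (S : Set ℝ) : EReal :=
  if S.Nonempty then sSup ((fun r : ℝ => (r : EReal)) '' S) else ⊤

open Classical in
/-- Square root on the extended reals (`√(+∞) = +∞`; only used at nonnegative arguments). -/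
def esqrt (x : EReal) : EReal :=
  if x = ⊤ then ⊤ else ((Real.sqrt x.toReal : ℝ) : EReal)

/-- The loss is `γ⁻¹`-smooth. -/
def SmoothLoss (φ : ℝ → ℝ) (γ : ℝ) : Prop :=
  0 < γ ∧ Differentiable ℝ φ ∧ ∀ a b : ℝ, |deriv φ a - deriv φ b| ≤ γ⁻¹ * |a - b|

/-- The penalty is subdifferentiable and `lam`-strongly convex. -/
def StronglyConvexPenalty {d : ℕ} (ψ : EuclideanSpace ℝ (Fin d) → ℝ) (lam : ℝ) : Prop :=
  0 < lam ∧ (∀ b, (subdiff (fun v => (ψ v : EReal)) b).Nonempty) ∧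
    ∀ a b, ∀ g ∈ subdiff (fun v => (ψ v : EReal)) b,
      ψ b + inner ℝ g (a - b) + lam / 2 * ‖a - b‖ ^ 2 ≤ ψ a

/-! ### The primal and the dual problem -/

/-- The `i`-th row of a matrix as a Euclidean vector. -/
def row {n d : ℕ} (A : Matrix (Fin n) (Fin d) ℝ) (i : Fin n) : EuclideanSpace ℝ (Fin d) :=
  WithLp.toLp 2 (fun j => A i j)

/-- The `j`-th column of a matrix as a Euclidean vector. -/
def col {n d : ℕ} (A : Matrix (Fin n) (Fin d) ℝ) (j : Fin d) : EuclideanSpace ℝ (Fin n) :=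
  WithLp.toLp 2 (fun i => A i j)

/-- `Z = diag(y) X`. -/
def signed {n d : ℕ} (y : Fin n → ℝ) (X : Matrix (Fin n) (Fin d) ℝ) : Matrix (Fin n) (Fin d) ℝ :=
  Matrix.diagonal y * X

/-- Primal objective `P(w) = n⁻¹ ∑ᵢ φ(zᵢ·w) + ψ(w)`. -/
def primal {n d : ℕ} (φ : ℝ → ℝ) (ψ : EuclideanSpace ℝ (Fin d) → ℝ)
    (Z : Matrix (Fin n) (Fin d) ℝ) (w : EuclideanSpace ℝ (Fin d)) : ℝ :=
  (n : ℝ)⁻¹ * ∑ i, φ (inner ℝ (row Z i) w) + ψ w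

/-- Dual objective `D(α) = - n⁻¹ ∑ᵢ φ*(-αᵢ) - ψ*(n⁻¹ Zᵀ α)`. -/
def dual {n d : ℕ} (φ : ℝ → ℝ) (ψ : EuclideanSpace ℝ (Fin d) → ℝ)
    (Z : Matrix (Fin n) (Fin d) ℝ) (α : EuclideanSpace ℝ (Fin n)) : EReal :=
  -((((n : ℝ)⁻¹ : ℝ) : EReal) * ∑ i, conj φ (-(α i)))
    - conj ψ (WithLp.toLp 2 (fun j => (n : ℝ)⁻¹ * inner ℝ (col Z j) α))

/-- Effective domain of the (concave) dual objective. -/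
def dualDom {n d : ℕ} (φ : ℝ → ℝ) (ψ : EuclideanSpace ℝ (Fin d) → ℝ)
    (Z : Matrix (Fin n) (Fin d) ℝ) : Set (EuclideanSpace ℝ (Fin n)) :=
  {α | dual φ ψ Z α ≠ ⊥}

/-- `inf` over the dual domain of `n⁻¹ z_{·j}ᵀ α`. -/
def infCorr {n d : ℕ} (φ : ℝ → ℝ) (ψ : EuclideanSpace ℝ (Fin d) → ℝ)
    (Z : Matrix (Fin n) (Fin d) ℝ) (j : Fin d) : EReal :=
  ⨅ α ∈ dualDom φ ψ Z, (((n : ℝ)⁻¹ * inner ℝ (col Z j) α : ℝ) : EReal)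

/-- `sup` over the dual domain of `n⁻¹ z_{·j}ᵀ α`. -/
def supCorr {n d : ℕ} (φ : ℝ → ℝ) (ψ : EuclideanSpace ℝ (Fin d) → ℝ)
    (Z : Matrix (Fin n) (Fin d) ℝ) (j : Fin d) : EReal :=
  ⨆ α ∈ dualDom φ ψ Z, (((n : ℝ)⁻¹ * inner ℝ (col Z j) α : ℝ) : EReal)

/-- `inf` over the dual domain of `αᵢ`. -/
def infDual {n d : ℕ} (φ : ℝ → ℝ) (ψ : EuclideanSpace ℝ (Fin d) → ℝ)
    (Z : Matrix (Fin n) (Fin d) ℝ) (i : Fin n) : EReal :=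
  ⨅ α ∈ dualDom φ ψ Z, ((α i : ℝ) : EReal)

/-- `sup` over the dual domain of `αᵢ`. -/
def supDual {n d : ℕ} (φ : ℝ → ℝ) (ψ : EuclideanSpace ℝ (Fin d) → ℝ)
    (Z : Matrix (Fin n) (Fin d) ℝ) (i : Fin n) : EReal :=
  ⨆ α ∈ dualDom φ ψ Z, ((α i : ℝ) : EReal)

/-! ### Data modification -/

/-- The data: loss, penalty and its components, labels, old and new input matrix, the set of
modified entries, a primal-dual pair for the old problem, and the two parameters. -/
structure Setup (n d : ℕ) where
  φ : ℝ → ℝ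
  ψ : EuclideanSpace ℝ (Fin d) → ℝ
  ψc : Fin d → ℝ → ℝ
  y : Fin n → ℝ
  Xold : Matrix (Fin n) (Fin d) ℝ
  Xnew : Matrix (Fin n) (Fin d) ℝ
  M : Finset (Fin n × Fin d)
  wOld : EuclideanSpace ℝ (Fin d)
  αOld : EuclideanSpace ℝ (Fin n)
  γ : ℝ
  lam : ℝ

namespace Setup

variable {n d : ℕ} (S : Setup n d)

def Zold : Matrix (Fin n) (Fin d) ℝ := signed S.y S.Xold

def Znew : Matrix (Fin n) (Fin d) ℝ := signed S.y S.Xnew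

/-- Standing assumptions: convex nonnegative loss and penalty, decomposable penalty, labels `±1`,
no entry outside `M` is changed, and `(wOld, αOld)` is a primal-dual optimal pair of the old
problem. -/
structure Standing : Prop where
  n_pos : 0 < n
  loss_convex : ConvexOn ℝ Set.univ S.φ
  loss_nonneg : ∀ r, 0 ≤ S.φ r
  penalty_convex : ConvexOn ℝ Set.univ S.ψ
  penalty_nonneg : ∀ w, 0 ≤ S.ψ w
  component_convex : ∀ j, ConvexOn ℝ Set.univ (S.ψc j)
  decomposable : ∀ w, S.ψ w = ∑ j, S.ψc j (w j)
  label : ∀ i, S.y i = 1 ∨ S.y i = -1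
  unmodified : ∀ i j, (i, j) ∉ S.M → S.Xnew i j = S.Xold i j
  wOld_opt : IsMinOn (primal S.φ S.ψ S.Zold) Set.univ S.wOld
  αOld_opt : IsMaxOn (dual S.φ S.ψ S.Zold) Set.univ S.αOld

/-- `(w, α)` is a primal-dual optimal pair of the new problem. -/
def NewOptimal (w : EuclideanSpace ℝ (Fin d)) (α : EuclideanSpace ℝ (Fin n)) : Prop :=
  IsMinOn (primal S.φ S.ψ S.Znew) Set.univ w ∧ IsMaxOn (dual S.φ S.ψ S.Znew) Set.univ α

/-- `n⁻¹ ∑_{i ∈ M_i} (φ(z̃ᵢ·ŵ) - φ(ẑᵢ·ŵ)) + ∑_{j ∈ M_j} (ψ*_j(n⁻¹ z̃_{·j}·α̂) - ψ*_j(n⁻¹ ẑ_{·j}·α̂))`,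
with `M_i`, `M_j` the sets of rows and of columns that contain a modified entry. -/
def gap : EReal :=
  (((n : ℝ)⁻¹ * ∑ i ∈ S.M.image Prod.fst,
      (S.φ (inner ℝ (row S.Znew i) S.wOld) - S.φ (inner ℝ (row S.Zold i) S.wOld)) : ℝ) : EReal)
    + ∑ j ∈ S.M.image Prod.snd,
      (conj (S.ψc j) ((n : ℝ)⁻¹ * inner ℝ (col S.Znew j) S.αOld)
        - conj (S.ψc j) ((n : ℝ)⁻¹ * inner ℝ (col S.Zold j) S.αOld))

/-! Bounds from the dual sphere. -/

def LDw (j : Fin d) : EReal :=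
  infOf (subdiffAt (conj (S.ψc j))
    (max (infCorr S.φ S.ψ S.Znew j)
      ((((n : ℝ)⁻¹ * inner ℝ (col S.Znew j) S.αOld : ℝ) : EReal)
        - ((‖col S.Xnew j‖ : ℝ) : EReal) * esqrt (((2 * S.γ⁻¹ : ℝ) : EReal) * S.gap))))

def UDw (j : Fin d) : EReal :=
  supOf (subdiffAt (conj (S.ψc j))
    (min (supCorr S.φ S.ψ S.Znew j)
      ((((n : ℝ)⁻¹ * inner ℝ (col S.Znew j) S.αOld : ℝ) : EReal)
        + ((‖col S.Xnew j‖ : ℝ) : EReal) * esqrt (((2 * S.γ⁻¹ : ℝ) : EReal) * S.gap))))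

def LDα (i : Fin n) : EReal :=
  max (infDual S.φ S.ψ S.Znew i)
    (((S.αOld i : ℝ) : EReal) - esqrt (((2 * (n : ℝ) * S.γ⁻¹ : ℝ) : EReal) * S.gap))

def UDα (i : Fin n) : EReal :=
  min (supDual S.φ S.ψ S.Znew i)
    (((S.αOld i : ℝ) : EReal) + esqrt (((2 * (n : ℝ) * S.γ⁻¹ : ℝ) : EReal) * S.gap))

/-! Bounds from the primal sphere. -/

def LPw (j : Fin d) : EReal :=
  ((S.wOld j : ℝ) : EReal) - esqrt (((2 * S.lam⁻¹ : ℝ) : EReal) * S.gap)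

def UPw (j : Fin d) : EReal :=
  ((S.wOld j : ℝ) : EReal) + esqrt (((2 * S.lam⁻¹ : ℝ) : EReal) * S.gap)

def LPα (i : Fin n) : EReal :=
  infOf ((fun g => -g) '' subdiffAt (fun r => (S.φ r : EReal))
    (((inner ℝ (row S.Znew i) S.wOld : ℝ) : EReal)
      + ((‖row S.Xnew i‖ : ℝ) : EReal) * esqrt (((2 * S.lam⁻¹ : ℝ) : EReal) * S.gap)))

def UPα (i : Fin n) : EReal :=
  supOf ((fun g => -g) '' subdiffAt (fun r => (S.φ r : EReal))
    (((inner ℝ (row S.Znew i) S.wOld : ℝ) : EReal)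
      - ((‖row S.Xnew i‖ : ℝ) : EReal) * esqrt (((2 * S.lam⁻¹ : ℝ) : EReal) * S.gap)))

end Setup

/-- The three cases: smooth loss; strongly convex penalty; both. -/
inductive Case
  | smooth
  | strong
  | both

namespace Setup

variable {n d : ℕ} (S : Setup n d)

/-- The property assumed in each case. -/
def Has : Case → Prop
  | .smooth => SmoothLoss S.φ S.γ
  | .strong => StronglyConvexPenalty S.ψ S.lam
  | .both => SmoothLoss S.φ S.γ ∧ StronglyConvexPenalty S.ψ S.lam

def lowerW : Case → Fin d → EReal
  | .smooth, j => S.LDw j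
  | .strong, j => S.LPw j
  | .both, j => max (S.LPw j) (S.LDw j)

def upperW : Case → Fin d → EReal
  | .smooth, j => S.UDw j
  | .strong, j => S.UPw j
  | .both, j => min (S.UPw j) (S.UDw j)

def lowerα : Case → Fin n → EReal
  | .smooth, i => S.LDα i
  | .strong, i => S.LPα i
  | .both, i => max (S.LPα i) (S.LDα i)

def upperα : Case → Fin n → EReal
  | .smooth, i => S.UDα i
  | .strong, i => S.UPα i
  | .both, i => min (S.UPα i) (S.UDα i)

end Setup

/-! ### A random access machine over the extended reals with a step count -/

/-- Read-only scalars: `n`, `γ`, `lam`, and the end points of `-dom φ*`. -/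
inductive ScalarName
  | size
  | gamma
  | lambda
  | dualLo
  | dualHi

/-- Read-only arrays. Those indexed by rows: `ẑᵢ·ŵ`, `‖x̂ᵢ‖`, `α̂ᵢ`, `yᵢ`, and `inf`, `sup` of `αᵢ`
over the new dual domain. Those indexed by columns: `ẑ_{·j}·α̂`, `‖x̂_{·j}‖`, `ŵ_j`, and `inf`, `sup`
of `n⁻¹ z_{·j}·α` over the dual domain, for the old and for the new problem. -/
inductive ArrayName
  | rowScore
  | rowNorm
  | oldAlpha
  | label
  | newInfDual
  | newSupDual
  | colCorr
  | colNorm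
  | oldW
  | oldInfCorr
  | oldSupCorr
  | newInfCorr
  | newSupCorr

/-- Read-only matrices. -/
inductive MatrixName
  | xOld
  | xNew

/-- Scalar functions of the problem that can be evaluated in one step: `φ`, `ψ*_j`,
`inf ∂ψ*_j`, `sup ∂ψ*_j`, `inf (-∂φ)`, `sup (-∂φ)`. -/
inductive FunName
  | loss
  | conjPenalty
  | infSubConjPenalty
  | supSubConjPenalty
  | infNegSubLoss
  | supNegSubLoss

/-- What a program can read. The modified entries are listed as number `0, …, count - 1`. -/
structure Input where
  count : ℕ
  modRow : ℕ → ℕ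
  modCol : ℕ → ℕ
  scalar : ScalarName → EReal
  array : ArrayName → ℕ → EReal
  matrix : MatrixName → ℕ → ℕ → EReal
  func : FunName → ℕ → EReal → EReal

/-- Index registers, value registers, and writable arrays. -/
structure Memory where
  idx : ℕ → ℕ
  val : ℕ → EReal
  work : ℕ → ℕ → EReal

def Memory.initial : Memory := ⟨fun _ => 0, fun _ => 0, fun _ _ => 0⟩

inductive BinOp
  | add
  | sub
  | mul
  | max
  | min

def BinOp.eval : BinOp → EReal → EReal → EReal
  | .add, a, b => a + b
  | .sub, a, b => a - b
  | .mul, a, b => a * b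
  | .max, a, b => Max.max a b
  | .min, a, b => Min.min a b

/-- Programs. `r, a, b` are numbers of value registers, `i, j, t` of index registers, and `k` of a
writable array. -/
inductive Cmd
  | skip
  | seq (c₁ c₂ : Cmd)
  | const (r : ℕ) (m : ℕ)
  | op (o : BinOp) (r a b : ℕ)
  | inv (r a : ℕ)
  | sqrt (r a : ℕ)
  | readScalar (r : ℕ) (s : ScalarName)
  | readArray (r : ℕ) (A : ArrayName) (i : ℕ)
  | readMatrix (r : ℕ) (A : MatrixName) (i j : ℕ)
  | apply (r : ℕ) (f : FunName) (i a : ℕ)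
  | load (r k i : ℕ)
  | store (k i r : ℕ)
  | modRow (i t : ℕ)
  | modCol (j t : ℕ)
  | ifLe (a b : ℕ) (c₁ c₂ : Cmd)
  | forMod (t : ℕ) (c : Cmd)

def Memory.setVal (σ : Memory) (r : ℕ) (x : EReal) : Memory :=
  { σ with val := Function.update σ.val r x }

def Memory.setIdx (σ : Memory) (i m : ℕ) : Memory :=
  { σ with idx := Function.update σ.idx i m }

def Memory.setWork (σ : Memory) (k m : ℕ) (x : EReal) : Memory :=
  { σ with work := Function.update σ.work k (Function.update (σ.work k) m x) }

open Classical in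
/-- Runs a program; returns the final memory and the number of steps. Every elementary command,
every test and every pass through a loop costs one step; `forMod t c` runs `c` for each modified
entry, whose number is put into the index register `t`. -/
def exec (I : Input) : Cmd → Memory → Memory × ℕ
  | .skip, σ => (σ, 1)
  | .seq c₁ c₂, σ =>
      let p := exec I c₁ σ
      let q := exec I c₂ p.1
      (q.1, p.2 + q.2)
  | .const r m, σ => (σ.setVal r (m : EReal), 1)
  | .op o r a b, σ => (σ.setVal r (o.eval (σ.val a) (σ.val b)), 1)
  | .inv r a, σ => (σ.setVal r (σ.val a)⁻¹, 1)
  | .sqrt r a, σ => (σ.setVal r (esqrt (σ.val a)), 1)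
  | .readScalar r s, σ => (σ.setVal r (I.scalar s), 1)
  | .readArray r A i, σ => (σ.setVal r (I.array A (σ.idx i)), 1)
  | .readMatrix r A i j, σ => (σ.setVal r (I.matrix A (σ.idx i) (σ.idx j)), 1)
  | .apply r f i a, σ => (σ.setVal r (I.func f (σ.idx i) (σ.val a)), 1)
  | .load r k i, σ => (σ.setVal r (σ.work k (σ.idx i)), 1)
  | .store k i r, σ => (σ.setWork k (σ.idx i) (σ.val r), 1)
  | .modRow i t, σ => (σ.setIdx i (I.modRow (σ.idx t)), 1)
  | .modCol j t, σ => (σ.setIdx j (I.modCol (σ.idx t)), 1)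
  | .ifLe a b c₁ c₂, σ =>
      let p := if σ.val a ≤ σ.val b then exec I c₁ σ else exec I c₂ σ
      (p.1, p.2 + 1)
  | .forMod t c, σ =>
      (List.range I.count).foldl
        (fun p m =>
          let q := exec I c (p.1.setIdx t m)
          (q.1, p.2 + q.2 + 1))
        (σ, 1)

/-- The two contents of the store: without or with the extremal values over the dual domain of
the new problem. -/
inductive Store
  | oldOnly
  | withNewExtrema

/-- A family indexed by `Fin m` as an array, `0` outside its range. -/
def toArray {m : ℕ} (f : Fin m → EReal) (k : ℕ) : EReal :=
  if h : k < m then f ⟨k, h⟩ else 0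

namespace Setup

variable {n d : ℕ} (S : Setup n d)

/-- `-dom φ*`, the set of values that the loss admits for a dual variable. -/
def lossDual : Set ℝ := {a | conj S.φ (-a) ≠ ⊤}

def scalarOf : ScalarName → EReal
  | .size => (((n : ℕ) : ℝ) : EReal)
  | .gamma => (S.γ : EReal)
  | .lambda => (S.lam : EReal)
  | .dualLo => infOf S.lossDual
  | .dualHi => supOf S.lossDual

def arrayOf : Store → ArrayName → ℕ → EReal
  | _, .rowScore => toArray fun i => ((inner ℝ (row S.Zold i) S.wOld : ℝ) : EReal)
  | _, .rowNorm => toArray fun i => ((‖row S.Xold i‖ : ℝ) : EReal)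
  | _, .oldAlpha => toArray fun i => ((S.αOld i : ℝ) : EReal)
  | _, .label => toArray fun i => ((S.y i : ℝ) : EReal)
  | _, .colCorr => toArray fun j => ((inner ℝ (col S.Zold j) S.αOld : ℝ) : EReal)
  | _, .colNorm => toArray fun j => ((‖col S.Xold j‖ : ℝ) : EReal)
  | _, .oldW => toArray fun j => ((S.wOld j : ℝ) : EReal)
  | _, .oldInfCorr => toArray fun j => infCorr S.φ S.ψ S.Zold j
  | _, .oldSupCorr => toArray fun j => supCorr S.φ S.ψ S.Zold j
  | .withNewExtrema, .newInfCorr => toArray fun j => infCorr S.φ S.ψ S.Znew j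
  | .withNewExtrema, .newSupCorr => toArray fun j => supCorr S.φ S.ψ S.Znew j
  | .withNewExtrema, .newInfDual => toArray fun i => infDual S.φ S.ψ S.Znew i
  | .withNewExtrema, .newSupDual => toArray fun i => supDual S.φ S.ψ S.Znew i
  | .oldOnly, _ => fun _ => 0

def matrixOf : MatrixName → ℕ → ℕ → EReal
  | .xOld => fun k l => if h : k < n ∧ l < d then ((S.Xold ⟨k, h.1⟩ ⟨l, h.2⟩ : ℝ) : EReal) else 0
  | .xNew => fun k l => if h : k < n ∧ l < d then ((S.Xnew ⟨k, h.1⟩ ⟨l, h.2⟩ : ℝ) : EReal) else 0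

def funcOf : FunName → ℕ → EReal → EReal
  | .loss => fun _ t => ((S.φ t.toReal : ℝ) : EReal)
  | .conjPenalty => fun k t => toArray (fun j => conj (S.ψc j) t.toReal) k
  | .infSubConjPenalty => fun k t => toArray (fun j => infOf (subdiffAt (conj (S.ψc j)) t)) k
  | .supSubConjPenalty => fun k t => toArray (fun j => supOf (subdiffAt (conj (S.ψc j)) t)) k
  | .infNegSubLoss => fun _ t =>
      infOf ((fun g => -g) '' subdiffAt (fun r => (S.φ r : EReal)) t)
  | .supNegSubLoss => fun _ t =>
      supOf ((fun g => -g) '' subdiffAt (fun r => (S.φ r : EReal)) t)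

/-- The machine input for the instance `S`, with the modified entries listed in the order `l`. -/
def input (s : Store) (l : List (Fin n × Fin d)) : Input where
  count := l.length
  modRow := fun m => ((l[m]?).map fun p => (p.1 : ℕ)).getD 0
  modCol := fun m => ((l[m]?).map fun p => (p.2 : ℕ)).getD 0
  scalar := S.scalarOf
  array := S.arrayOf s
  matrix := S.matrixOf
  func := S.funcOf

/-- All `ψ*_j` are finite on the whole line; then the dual domain is `(-dom φ*)ⁿ` for all data. -/
def FiniteConj : Prop := ∀ j t, conj (S.ψc j) t ≠ ⊤

/-- Stored quantities that are enough for the bounds on all dual variables. -/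
def Enoughα : Store → Case → Prop
  | .withNewExtrema, _ => True
  | .oldOnly, .strong => True
  | .oldOnly, _ => S.FiniteConj

/-- Stored quantities that are enough for the bounds on the `j`-th primal coefficient. -/
def EnoughW : Store → Case → Fin d → Prop
  | .withNewExtrema, _, _ => True
  | .oldOnly, .strong, _ => True
  | .oldOnly, _, j => S.FiniteConj ∧
      infCorr S.φ S.ψ S.Zold j ≠ ⊥ ∧ supCorr S.φ S.ψ S.Zold j ≠ ⊤

end Setup

/-- The query `c`, started in the memory `σ` with its target index in index register `0`, leaves
`L` and `U` in the value registers `0` and `1` after at most `T` steps. -/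
def Answers (I : Input) (c : Cmd) (σ : Memory) (target : ℕ) (L U : EReal) (T : ℕ) : Prop :=
  (exec I c (σ.setIdx 0 target)).1.val 0 = L ∧
  (exec I c (σ.setIdx 0 target)).1.val 1 = U ∧
  (exec I c (σ.setIdx 0 target)).2 ≤ T

end ERM

end

noncomputable section

namespace ERM

/-! Write u_j = n⁻¹ z_{·j}ᵀα. For α in the dual domain, P(w) − D(α) is n⁻¹ times the sum of the loss
terms φ(z_i·w) + φ*(−α_i) + α_i z_i·w, plus the sum of the penalty terms ψ_j(w_j) + ψ_j*(u_j) − u_j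
w_j (`primal_sub_dual`). All of these are nonnegative by Fenchel's inequality. A Hahn–Banach
separation yields a dual point closing the gap at a primal minimizer, so every optimal pair has zero
gap and each term vanishes: −α_i ∈ ∂φ(z_i·w), u_j ∈ ∂ψ_j(w_j) and w_j ∈ ∂ψ_j*(u_j)
(`certificate_of_optimal`). Subtracting the zero gap of the old pair from its gap in the new problem
leaves only modified rows and columns, which is the formula for G̃ (`Standing.gap_eq`).

If φ is smooth, a loss term is at least γ/2 times the squared distance from −α_i to φ'(z_i·w).
Applied to the new w and the old α, whose gap is at most G̃, this puts the new α in a ball around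
the old one (`Standing.sphere_dual`). If ψ is strongly convex, weak duality bounds the excess of P̃
at the old w by G̃, so the new w lies in a ball around the old one (`Standing.sphere_primal`).
Cauchy–Schwarz turns a ball into intervals for coordinates and scores; monotone subdifferentials
carry these intervals to the other variable.

For the running time, scores, correlations and squared norms change by sums over modified entries. A
modified row must enter G̃ once, however many of its entries changed, so each entry carries the row
term divided by the number of modified entries in that row; columns are treated alike
(`sum_inv_fibre_card`). If all ψ_j* are finite, the dual domain is a product, the extremum for a
column is a sum of extrema for its entries, and finite old summands can be exchanged for new ones
(`add_planned_box`). A query is then an expression of bounded size in the stored data and the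
accumulated sums. -/

/-! ### Conjugates and subgradients -/

theorem conj_ne_bot {E : Type*} [NormedAddCommGroup E] [InnerProductSpace ℝ E] (f : E → ℝ) (u : E) :
    conj f u ≠ ⊥ :=
  ne_bot_of_le_ne_bot (EReal.coe_ne_bot _)
    (le_iSup (fun v : E => ((inner ℝ u v - f v : ℝ) : EReal)) 0)

theorem le_conj {E : Type*} [NormedAddCommGroup E] [InnerProductSpace ℝ E] (f : E → ℝ) (u v : E) :
    ((inner ℝ u v - f v : ℝ) : EReal) ≤ conj f u :=
  le_iSup (fun v : E => ((inner ℝ u v - f v : ℝ) : EReal)) v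

theorem mem_subdiff_coe {E : Type*} [NormedAddCommGroup E] [InnerProductSpace ℝ E] {f : E → ℝ}
    {g x : E} :
    g ∈ subdiff (fun v => (f v : EReal)) x ↔ ∀ v, f x + inner ℝ g (v - x) ≤ f v := by
  simp only [subdiff, Set.mem_ofPred_eq]
  exact forall_congr' fun v => by rw [← EReal.coe_add, EReal.coe_le_coe_iff]

/-- Equality case of Fenchel's inequality: the subgradient inequality says that `x` maximizes ⟨g, v⟩
− f v. -/
theorem conj_eq_of_mem_subdiff {E : Type*} [NormedAddCommGroup E] [InnerProductSpace ℝ E]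
    {f : E → ℝ} {g x : E} (h : g ∈ subdiff (fun v => (f v : EReal)) x) :
    conj f g = ((inner ℝ g x - f x : ℝ) : EReal) := by
  refine le_antisymm (iSup_le fun v => ?_) (le_conj f g x)
  have := mem_subdiff_coe.1 h v
  rw [inner_sub_right] at this
  exact EReal.coe_le_coe_iff.2 (by linarith)

theorem mem_subdiff_of_conj_eq {E : Type*} [NormedAddCommGroup E] [InnerProductSpace ℝ E]
    {f : E → ℝ} {g x : E} (h : conj f g = ((inner ℝ g x - f x : ℝ) : EReal)) :
    g ∈ subdiff (fun v => (f v : EReal)) x := by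
  refine mem_subdiff_coe.2 fun v => ?_
  have := le_conj f g v
  rw [h, EReal.coe_le_coe_iff] at this
  rw [inner_sub_right]
  linarith

/-- The conjugate is a supremum of affine functions, and the one indexed by `x` touches it at `g`.
Convexity of `f` plays no role. -/
theorem mem_subdiff_conj_of_conj_eq {E : Type*} [NormedAddCommGroup E] [InnerProductSpace ℝ E]
    {f : E → ℝ} {g x : E} (h : conj f g = ((inner ℝ g x - f x : ℝ) : EReal)) :
    x ∈ subdiff (conj f) g := by
  intro v
  rw [h, ← EReal.coe_add]
  refine le_trans (EReal.coe_le_coe_iff.2 ?_) (le_conj f v x)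
  rw [inner_sub_right, real_inner_comm x g, real_inner_comm x v]
  linarith

/-! ### Sums in the extended reals -/

theorem ereal_coe_sum {ι : Type*} (s : Finset ι) (f : ι → ℝ) :
    ((∑ i ∈ s, f i : ℝ) : EReal) = ∑ i ∈ s, (f i : EReal) :=
  map_sum (AddMonoidHom.mk ⟨((↑) : ℝ → EReal), EReal.coe_zero⟩ EReal.coe_add) f s

theorem ereal_sum_ne_bot {ι : Type*} {s : Finset ι} {f : ι → EReal} (h : ∀ i ∈ s, f i ≠ ⊥) :
    ∑ i ∈ s, f i ≠ ⊥ := by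
  classical
  induction s using Finset.induction_on with
  | empty => simp
  | insert a s ha ih =>
    rw [Finset.sum_insert ha]
    simp only [Finset.mem_insert, forall_eq_or_imp] at h
    exact fun hb => (EReal.add_eq_bot_iff.1 hb).elim h.1 (ih h.2)

theorem ereal_sum_ne_top_iff {ι : Type*} {s : Finset ι} {f : ι → EReal} (h : ∀ i ∈ s, f i ≠ ⊥) :
    ∑ i ∈ s, f i ≠ ⊤ ↔ ∀ i ∈ s, f i ≠ ⊤ := by
  classical
  induction s using Finset.induction_on with
  | empty => simp
  | insert a s ha ih =>
    rw [Finset.sum_insert ha]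
    simp only [Finset.mem_insert, forall_eq_or_imp] at h ⊢
    rw [← ih h.2, EReal.add_ne_top_iff_ne_top₂ h.1 (ereal_sum_ne_bot h.2)]

theorem ereal_mul_sum {ι : Type*} {s : Finset ι} {f : ι → EReal} {c : ℝ} (hc : 0 ≤ c) :
    (c : EReal) * ∑ i ∈ s, f i = ∑ i ∈ s, (c : EReal) * f i := by
  classical
  induction s using Finset.induction_on with
  | empty => simp
  | insert a s ha ih =>
    rw [Finset.sum_insert ha, Finset.sum_insert ha, ← ih,
      EReal.left_distrib_of_nonneg_of_ne_top (EReal.coe_nonneg.2 hc) (EReal.coe_ne_top _)]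

/-- The supremum of a separable sum is the sum of the suprema. -/
theorem iSup_sum_pi {ι A : Type*} [Fintype ι] [Nonempty A] (f : ι → A → ℝ) :
    ⨆ v : ι → A, ((∑ i, f i (v i) : ℝ) : EReal) = ∑ i, ⨆ a, (f i a : EReal) := by
  classical
  refine le_antisymm (iSup_le fun v => ?_) ?_
  · rw [ereal_coe_sum]
    exact Finset.sum_le_sum fun i _ => le_iSup (fun a => (f i a : EReal)) (v i)
  · have key : ∀ s : Finset ι, ∑ i ∈ s, ⨆ a, (f i a : EReal) ≤
        ⨆ v : ι → A, ((∑ i ∈ s, f i (v i) : ℝ) : EReal) := by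
      intro s
      induction s using Finset.induction_on with
      | empty => simp
      | insert k s hk ih =>
        rw [Finset.sum_insert hk]
        -- Bounds strictly below the two suprema replace maximizers, so infinite suprema need no
        -- separate case.
        refine EReal.add_le_of_forall_lt fun a' ha b' hb => ?_
        obtain ⟨a, ha⟩ := lt_iSup_iff.1 ha
        obtain ⟨v, hv⟩ := lt_iSup_iff.1 (hb.trans_le ih)
        refine le_trans (add_le_add ha.le hv.le) (le_trans (le_of_eq ?_) (le_iSup _ (Function.update v k a)))
        rw [← EReal.coe_add, Finset.sum_insert hk, Function.update_self]
        congr 2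
        refine Finset.sum_congr rfl fun i hi => ?_
        rw [Function.update_of_ne (ne_of_mem_of_not_mem hi hk)]
    exact key Finset.univ

theorem conj_separable {d : ℕ} {ψ : EuclideanSpace ℝ (Fin d) → ℝ} {ψc : Fin d → ℝ → ℝ}
    (h : ∀ w, ψ w = ∑ j, ψc j (w j)) (u : EuclideanSpace ℝ (Fin d)) :
    conj ψ u = ∑ j, conj (ψc j) (u j) := by
  unfold conj
  rw [← iSup_sum_pi, ← (WithLp.equiv 2 (Fin d → ℝ)).symm.iSup_comp]
  refine iSup_congr fun v => ?_
  rw [h, Finset.sum_sub_distrib, PiLp.inner_apply]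
  rfl

/-! ### The duality gap as a sum of Fenchel–Young gaps -/

section Gap

variable {n d : ℕ} {φ : ℝ → ℝ} {ψ : EuclideanSpace ℝ (Fin d) → ℝ} {ψc : Fin d → ℝ → ℝ}

theorem dual_eq (h : ∀ w, ψ w = ∑ j, ψc j (w j)) (Z : Matrix (Fin n) (Fin d) ℝ)
    (α : EuclideanSpace ℝ (Fin n)) :
    dual φ ψ Z α = -((((n : ℝ)⁻¹ : ℝ) : EReal) * ∑ i, conj φ (-(α i)))
      - ∑ j, conj (ψc j) ((n : ℝ)⁻¹ * inner ℝ (col Z j) α) := by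
  rw [dual, conj_separable h]

/-- No conjugate takes the value −∞, so a sum of conjugates is finite exactly when each summand is.
-/
theorem mem_dualDom_iff (hn : 0 < n) (h : ∀ w, ψ w = ∑ j, ψc j (w j))
    {Z : Matrix (Fin n) (Fin d) ℝ} {α : EuclideanSpace ℝ (Fin n)} :
    α ∈ dualDom φ ψ Z ↔ (∀ i, conj φ (-(α i)) ≠ ⊤) ∧
      ∀ j, conj (ψc j) ((n : ℝ)⁻¹ * inner ℝ (col Z j) α) ≠ ⊤ := by
  have hn' : (0 : ℝ) < (n : ℝ)⁻¹ := by positivity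
  rw [dualDom, Set.mem_ofPred_eq, dual_eq h, sub_eq_add_neg, Ne, EReal.add_eq_bot_iff,
    EReal.neg_eq_bot_iff, EReal.neg_eq_bot_iff, ereal_mul_sum hn'.le, not_or]
  refine and_congr ?_ ?_
  · refine (ereal_sum_ne_top_iff fun i _ => ?_).trans ?_
    · rw [Ne, EReal.mul_eq_bot]; simp [conj_ne_bot]
    · simp [EReal.mul_eq_top, conj_ne_bot, hn']
  · refine (ereal_sum_ne_top_iff fun i _ => conj_ne_bot _ _).trans (by simp)

theorem dual_eq_coe (hn : 0 < n) (h : ∀ w, ψ w = ∑ j, ψc j (w j))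
    {Z : Matrix (Fin n) (Fin d) ℝ} {α : EuclideanSpace ℝ (Fin n)} (hα : α ∈ dualDom φ ψ Z) :
    dual φ ψ Z α = ((-((n : ℝ)⁻¹ * ∑ i, (conj φ (-(α i))).toReal)
      - ∑ j, (conj (ψc j) ((n : ℝ)⁻¹ * inner ℝ (col Z j) α)).toReal : ℝ) : EReal) := by
  obtain ⟨h₁, h₂⟩ := (mem_dualDom_iff hn h).1 hα
  rw [dual_eq h, EReal.coe_sub, EReal.coe_neg, EReal.coe_mul, ereal_coe_sum, ereal_coe_sum]
  simp only [EReal.coe_toReal (h₁ _) (conj_ne_bot _ _), EReal.coe_toReal (h₂ _) (conj_ne_bot _ _)]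

/-- Fenchel–Young gap of `f` at the pair `(u, v)`. -/
def fenchelGap (f : ℝ → ℝ) (u v : ℝ) : ℝ := f v + (conj f u).toReal - u * v

/-- Fenchel's inequality. Finiteness is needed because `toReal` sends `⊤` to 0. -/
theorem fenchelGap_nonneg {f : ℝ → ℝ} {u : ℝ} (hu : conj f u ≠ ⊤) (v : ℝ) :
    0 ≤ fenchelGap f u v := by
  have := le_conj f u v
  rw [← EReal.coe_toReal hu (conj_ne_bot _ _), EReal.coe_le_coe_iff] at this
  simp only [RCLike.inner_apply, conj_trivial] at this
  unfold fenchelGap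
  linarith

theorem conj_eq_of_fenchelGap_eq_zero {f : ℝ → ℝ} {u v : ℝ} (hu : conj f u ≠ ⊤)
    (h : fenchelGap f u v = 0) : conj f u = ((inner ℝ u v - f v : ℝ) : EReal) := by
  rw [← EReal.coe_toReal hu (conj_ne_bot _ _), EReal.coe_eq_coe_iff]
  simp only [RCLike.inner_apply, conj_trivial]
  unfold fenchelGap at h
  linarith

theorem fenchelGap_eq_zero {f : ℝ → ℝ} {u v : ℝ}
    (h : conj f u = ((inner ℝ u v - f v : ℝ) : EReal)) : fenchelGap f u v = 0 := by
  rw [fenchelGap, h, EReal.toReal_coe]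
  simp only [RCLike.inner_apply, conj_trivial]
  ring

/-- Both sides are αᵀZw. This identity cancels the cross terms of the loss gaps against those of the
penalty gaps. -/
theorem sum_inner_row_col (Z : Matrix (Fin n) (Fin d) ℝ) (α : EuclideanSpace ℝ (Fin n))
    (w : EuclideanSpace ℝ (Fin d)) :
    ∑ j, inner ℝ (col Z j) α * w j = ∑ i, α i * inner ℝ (row Z i) w := by
  simp only [PiLp.inner_apply, row, col, RCLike.inner_apply, conj_trivial, Finset.sum_mul,
    Finset.mul_sum]
  rw [Finset.sum_comm]
  exact Finset.sum_congr rfl fun i _ => Finset.sum_congr rfl fun j _ => by ring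

theorem primal_sub_dual (hn : 0 < n) (h : ∀ w, ψ w = ∑ j, ψc j (w j))
    {Z : Matrix (Fin n) (Fin d) ℝ} {α : EuclideanSpace ℝ (Fin n)} (hα : α ∈ dualDom φ ψ Z)
    (w : EuclideanSpace ℝ (Fin d)) :
    (primal φ ψ Z w : EReal) - dual φ ψ Z α =
      (((n : ℝ)⁻¹ * ∑ i, fenchelGap φ (-(α i)) (inner ℝ (row Z i) w)
        + ∑ j, fenchelGap (ψc j) ((n : ℝ)⁻¹ * inner ℝ (col Z j) α) (w j) : ℝ) : EReal) := by
  rw [dual_eq_coe hn h hα, ← EReal.coe_sub, EReal.coe_eq_coe_iff, primal, h]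
  simp only [fenchelGap, Finset.sum_sub_distrib, Finset.sum_add_distrib, mul_assoc, neg_mul,
    Finset.sum_neg_distrib]
  rw [← Finset.mul_sum _ _ (n : ℝ)⁻¹, sum_inner_row_col]
  ring

end Gap

/-! ### Attainment of the dual optimum -/

/-- A convex function that is minimal at the origin along a subspace has there a subgradient that
vanishes on the subspace. -/
theorem exists_subgradient_vanishing {E : Type*} [NormedAddCommGroup E] [NormedSpace ℝ E]
    [FiniteDimensional ℝ E] {F : E → ℝ} (hF : ConvexOn ℝ Set.univ F) (V : Submodule ℝ E)
    (hV : ∀ v ∈ V, F 0 ≤ F v) :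
    ∃ g : E →L[ℝ] ℝ, (∀ v ∈ V, g v = 0) ∧ ∀ x, F 0 + g x ≤ F x := by
  have hcont : Continuous F := by
    rw [← continuousOn_univ]; exact hF.continuousOn isOpen_univ
  -- The open strict epigraph is separated from V × {F 0}; minimality on V makes the two disjoint.
  have hconv : Convex ℝ {p : E × ℝ | F p.1 < p.2} := by
    simpa using hF.convex_strict_epigraph
  have hopen : IsOpen {p : E × ℝ | F p.1 < p.2} :=
    isOpen_lt (hcont.comp continuous_fst) continuous_snd
  have hdisj : Disjoint {p : E × ℝ | F p.1 < p.2} ((V : Set E) ×ˢ {F 0}) := by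
    rw [Set.disjoint_left]
    rintro ⟨x, r⟩ hx ⟨hxV, hr⟩
    simp only [Set.mem_singleton_iff] at hr
    simp only [Set.mem_ofPred_eq, hr] at hx
    exact absurd (hV x hxV) (not_le.2 hx)
  obtain ⟨f, u, hs, ht⟩ := geometric_hahn_banach_open hconv hopen
    (V.convex.prod (convex_singleton (F 0))) hdisj
  have hf : ∀ x r, f (x, r) = f (x, 0) + r * f (0, 1) := by
    intro x r
    have : ((x, r) : E × ℝ) = (x, 0) + r • (0, 1) := by simp
    rw [this, map_add, map_smul, smul_eq_mul]
  set c := f (0, 1) with hc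
  have h00 : f ((0 : E), (0 : ℝ)) = 0 := map_zero f
  have hu0 : u ≤ F 0 * c := by
    have := ht (0, F 0) ⟨V.zero_mem, rfl⟩
    rwa [hf, h00, zero_add] at this
  have hcneg : c < 0 := by
    have := hs (0, F 0 + 1) (by simp)
    rw [hf, h00] at this
    linarith
  have hle : ∀ x, f (x, 0) + F x * c ≤ u := by
    intro x
    refine le_of_forall_pos_lt_add fun ε hε => ?_
    -- The graph only bounds the strict epigraph; a height ε/(−c) above it costs exactly ε in the
    -- functional.
    have := hs (x, F x + ε / (-c)) (by
      have : 0 < ε / (-c) := div_pos hε (by linarith)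
      simpa using this)
    rw [hf] at this
    have e : ε / (-c) * c = -ε := by rw [div_neg, neg_mul, div_mul_cancel₀ _ hcneg.ne]
    linarith [add_mul (F x) (ε / (-c)) c]
  have hvan : ∀ v ∈ V, f (v, 0) = 0 := by
    intro v hv
    have hb : ∀ t : ℝ, u - F 0 * c ≤ t * f (v, 0) := by
      intro t
      have := ht (t • v, F 0) ⟨V.smul_mem t hv, rfl⟩
      rw [hf] at this
      have e : ((t • v, 0) : E × ℝ) = t • (v, 0) := by simp
      rw [e, map_smul, smul_eq_mul] at this
      linarith
    by_contra hne
    -- A linear functional bounded below on a subspace vanishes there; this multiple would fall one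
    -- below the bound.
    have := hb ((u - F 0 * c - 1) / f (v, 0))
    rw [div_mul_cancel₀ _ hne] at this
    linarith
  refine ⟨(-c)⁻¹ • f.comp (ContinuousLinearMap.inl ℝ E ℝ), fun v hv => ?_, fun x => ?_⟩
  · simp [hvan v hv]
  · have h1 := hle x
    have h2 : (-c)⁻¹ * f (x, 0) ≤ F x - F 0 := by
      rw [inv_mul_le_iff₀ (by linarith)]
      linarith
    have h3 : ((-c)⁻¹ • f.comp (ContinuousLinearMap.inl ℝ E ℝ)) x = (-c)⁻¹ * f (x, 0) := rfl
    rw [h3]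
    linarith

section Duality

variable {n d : ℕ} {φ : ℝ → ℝ} {ψ : EuclideanSpace ℝ (Fin d) → ℝ} {ψc : Fin d → ℝ → ℝ}

/-- Scores and weights are perturbed independently here; the relation between them becomes the
subspace `V` of `exists_dual_certificate`. -/
theorem convexOn_shifted_primal (hφ : ConvexOn ℝ Set.univ φ) (hψ : ConvexOn ℝ Set.univ ψ)
    (c : EuclideanSpace ℝ (Fin n)) (w : EuclideanSpace ℝ (Fin d)) :
    ConvexOn ℝ Set.univ (fun p : EuclideanSpace ℝ (Fin n) × EuclideanSpace ℝ (Fin d) =>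
      (n : ℝ)⁻¹ * ∑ i, φ (c i + p.1 i) + ψ (w + p.2)) := by
  refine ⟨convex_univ, fun x _ y _ a b ha hb hab => ?_⟩
  have h1 : ∀ i, φ (c i + (a • x + b • y).1 i) ≤ a * φ (c i + x.1 i) + b * φ (c i + y.1 i) := by
    intro i
    have := hφ.2 (Set.mem_univ (c i + x.1 i)) (Set.mem_univ (c i + y.1 i)) ha hb hab
    refine le_trans (le_of_eq (congrArg φ ?_)) this
    simp only [Prod.fst_add, Prod.smul_fst, PiLp.add_apply, PiLp.smul_apply, smul_eq_mul]
    linear_combination (-c i) * hab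
  have h2 : ψ (w + (a • x + b • y).2) ≤ a * ψ (w + x.2) + b * ψ (w + y.2) := by
    have := hψ.2 (Set.mem_univ (w + x.2)) (Set.mem_univ (w + y.2)) ha hb hab
    refine le_trans (le_of_eq (congrArg ψ ?_)) this
    have hw : w = a • w + b • w := by rw [← add_smul, hab, one_smul]
    simp only [Prod.snd_add, Prod.smul_snd, smul_add]
    nth_rewrite 1 [hw]
    abel
  have h3 := mul_le_mul_of_nonneg_left (Finset.sum_le_sum fun i (_ : i ∈ Finset.univ) => h1 i)
    (by positivity : (0 : ℝ) ≤ (n : ℝ)⁻¹)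
  rw [Finset.sum_add_distrib, ← Finset.mul_sum, ← Finset.mul_sum] at h3
  simp only [smul_eq_mul]
  linarith

theorem primal_single_sub (h : ∀ w, ψ w = ∑ j, ψc j (w j)) (w : EuclideanSpace ℝ (Fin d))
    (j : Fin d) (t : ℝ) :
    ψ (w + EuclideanSpace.single j (t - w j)) - ψ w = ψc j t - ψc j (w j) := by
  rw [h, h, ← Finset.sum_sub_distrib, Finset.sum_eq_single j]
  · simp
  · intro k _ hk
    simp [hk]
  · simp

/-- A minimizer of the primal problem has a dual certificate. -/
theorem exists_dual_certificate (hn : 0 < n) (hφ : ConvexOn ℝ Set.univ φ)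
    (hψ : ConvexOn ℝ Set.univ ψ) (h : ∀ w, ψ w = ∑ j, ψc j (w j))
    {Z : Matrix (Fin n) (Fin d) ℝ} {w : EuclideanSpace ℝ (Fin d)}
    (hw : IsMinOn (primal φ ψ Z) Set.univ w) :
    ∃ α : EuclideanSpace ℝ (Fin n),
      (∀ i, -(α i) ∈ subdiff (fun r => (φ r : EReal)) (inner ℝ (row Z i) w)) ∧
      ∀ j, (n : ℝ)⁻¹ * inner ℝ (col Z j) α ∈ subdiff (fun r => (ψc j r : EReal)) (w j) := by
  have hn' : (n : ℝ) ≠ 0 := by positivity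
  let c : EuclideanSpace ℝ (Fin n) := WithLp.toLp 2 fun i => inner ℝ (row Z i) w
  -- `V` is the graph of v ↦ Zv, so minimality of `w` is minimality of the perturbed objective along
  -- `V`.
  let V : Submodule ℝ (EuclideanSpace ℝ (Fin n) × EuclideanSpace ℝ (Fin d)) :=
    { carrier := {p | ∀ i, p.1 i = inner ℝ (row Z i) p.2}
      add_mem' := fun {a b} ha hb i => by
        simp only [Prod.fst_add, Prod.snd_add, PiLp.add_apply, inner_add_right, ha i, hb i]
      zero_mem' := fun i => by simp
      smul_mem' := fun r a ha i => by
        simp only [Prod.smul_fst, Prod.smul_snd, PiLp.smul_apply, inner_smul_right, ha i,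
          smul_eq_mul] }
  have hmin : ∀ v ∈ V,
      (n : ℝ)⁻¹ * ∑ i, φ (c i + (0 : EuclideanSpace ℝ (Fin n) × EuclideanSpace ℝ (Fin d)).1 i)
        + ψ (w + (0 : EuclideanSpace ℝ (Fin n) × EuclideanSpace ℝ (Fin d)).2) ≤
      (n : ℝ)⁻¹ * ∑ i, φ (c i + v.1 i) + ψ (w + v.2) := by
    intro v hv
    have h1 : ∀ i, c i + v.1 i = inner ℝ (row Z i) (w + v.2) := fun i => by
      rw [inner_add_right, ← hv i]
    have h0 : ∀ i, c i = inner ℝ (row Z i) w := fun i => rfl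
    have := hw (Set.mem_univ (w + v.2))
    simp only [h1]
    simpa [h0, primal] using this
  obtain ⟨g, hgV, hg⟩ := exists_subgradient_vanishing (convexOn_shifted_primal hφ hψ c w) V hmin
  obtain ⟨a, ha⟩ := (InnerProductSpace.toDual ℝ (EuclideanSpace ℝ (Fin n))).surjective
    (g.comp (ContinuousLinearMap.inl ℝ _ _))
  obtain ⟨b, hb⟩ := (InnerProductSpace.toDual ℝ (EuclideanSpace ℝ (Fin d))).surjective
    (g.comp (ContinuousLinearMap.inr ℝ _ _))
  have ha' : ∀ u, g (u, 0) = inner ℝ a u := fun u => (congrArg (fun f => f u) ha).symm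
  have hb' : ∀ u, g (0, u) = inner ℝ b u := fun u => (congrArg (fun f => f u) hb).symm
  -- The pair (z_{·j}, e_j) lies in the graph, so ⟨a, z_{·j}⟩ + b_j = 0. The dual point is −n a: the
  -- factor n undoes the averaging of the losses, and the sign matches −α_i in the dual.
  have hab : ∀ j, (n : ℝ)⁻¹ * inner ℝ (col Z j) (-((n : ℝ) • a)) = b j := by
    intro j
    have h1 := hgV (col Z j, EuclideanSpace.single j 1) (fun i => by
      simp [col, row, EuclideanSpace.inner_single_right])
    have h2 : (col Z j, EuclideanSpace.single j (1 : ℝ)) =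
        (col Z j, (0 : EuclideanSpace ℝ (Fin d))) + (0, EuclideanSpace.single j (1 : ℝ)) := by simp
    rw [h2, map_add, ha', hb', EuclideanSpace.inner_single_right, real_inner_comm] at h1
    simp only [conj_trivial, one_mul] at h1
    rw [inner_neg_right, inner_smul_right, mul_neg, inv_mul_cancel_left₀ hn']
    linarith
  refine ⟨-((n : ℝ) • a), fun i => mem_subdiff_coe.2 fun r => ?_,
    fun j => mem_subdiff_coe.2 fun t => ?_⟩
  -- Perturbing a single score isolates a single loss; below, a single weight isolates one penalty
  -- component.
  · have h1 := hg (EuclideanSpace.single i (r - c i), 0)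
    rw [ha', EuclideanSpace.inner_single_right] at h1
    have h2 : ∑ k, φ (c k + EuclideanSpace.single i (r - c i) k) - ∑ k, φ (c k) =
        φ r - φ (c i) := by
      rw [← Finset.sum_sub_distrib, Finset.sum_eq_single i]
      · simp
      · intro k _ hk
        simp [hk]
      · simp
    simp only [Prod.fst_zero, Prod.snd_zero, PiLp.zero_apply, add_zero, conj_trivial] at h1
    have h3 : (r - c i) * a i ≤ (n : ℝ)⁻¹ * (φ r - φ (c i)) := by
      rw [← h2, mul_sub]; linarith
    rw [le_inv_mul_iff₀ (by positivity)] at h3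
    have h4 : inner ℝ (row Z i) w = c i := rfl
    simp only [h4, RCLike.inner_apply, conj_trivial, PiLp.neg_apply, PiLp.smul_apply, smul_eq_mul]
    linarith
  · have h1 := hg (0, EuclideanSpace.single j (t - w j))
    rw [hb', EuclideanSpace.inner_single_right] at h1
    have h2 := primal_single_sub h w j t
    simp only [Prod.fst_zero, Prod.snd_zero, PiLp.zero_apply, add_zero, conj_trivial] at h1
    rw [hab]
    simp only [RCLike.inner_apply, conj_trivial]
    linarith

/-- The optimality conditions that link a primal and a dual optimum. -/
structure Certificate (φ : ℝ → ℝ) (ψc : Fin d → ℝ → ℝ) (Z : Matrix (Fin n) (Fin d) ℝ)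
    (w : EuclideanSpace ℝ (Fin d)) (α : EuclideanSpace ℝ (Fin n)) : Prop where
  loss : ∀ i, conj φ (-(α i)) =
    ((inner ℝ (-(α i)) (inner ℝ (row Z i) w) - φ (inner ℝ (row Z i) w) : ℝ) : EReal)
  penalty : ∀ j, conj (ψc j) ((n : ℝ)⁻¹ * inner ℝ (col Z j) α) =
    ((inner ℝ ((n : ℝ)⁻¹ * inner ℝ (col Z j) α) (w j) - ψc j (w j) : ℝ) : EReal)

theorem Certificate.mem_dualDom {Z : Matrix (Fin n) (Fin d) ℝ} {w : EuclideanSpace ℝ (Fin d)}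
    {α : EuclideanSpace ℝ (Fin n)} (hc : Certificate φ ψc Z w α) (hn : 0 < n)
    (h : ∀ w, ψ w = ∑ j, ψc j (w j)) : α ∈ dualDom φ ψ Z :=
  (mem_dualDom_iff hn h).2
    ⟨fun i => by rw [hc.loss i]; exact EReal.coe_ne_top _,
      fun j => by rw [hc.penalty j]; exact EReal.coe_ne_top _⟩

theorem Certificate.primal_sub_dual {Z : Matrix (Fin n) (Fin d) ℝ}
    {w : EuclideanSpace ℝ (Fin d)}
    {α : EuclideanSpace ℝ (Fin n)} (hc : Certificate φ ψc Z w α) (hn : 0 < n)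
    (h : ∀ w, ψ w = ∑ j, ψc j (w j)) : (primal φ ψ Z w : EReal) - dual φ ψ Z α = 0 := by
  rw [ERM.primal_sub_dual hn h (hc.mem_dualDom hn h)]
  simp [fenchelGap_eq_zero (hc.loss _), fenchelGap_eq_zero (hc.penalty _)]

/-- A primal and a dual optimum satisfy the optimality conditions. -/
theorem certificate_of_optimal (hn : 0 < n) (hφ : ConvexOn ℝ Set.univ φ)
    (hψ : ConvexOn ℝ Set.univ ψ) (h : ∀ w, ψ w = ∑ j, ψc j (w j))
    {Z : Matrix (Fin n) (Fin d) ℝ} {w : EuclideanSpace ℝ (Fin d)} {α : EuclideanSpace ℝ (Fin n)}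
    (hw : IsMinOn (primal φ ψ Z) Set.univ w) (hα : IsMaxOn (dual φ ψ Z) Set.univ α) :
    Certificate φ ψc Z w α := by
  -- The certificate `β` has zero gap and `α` is at least as good, so the gap of `α` is at most 0.
  -- As a sum of nonnegative terms it vanishes term by term.
  obtain ⟨β, hβ₁, hβ₂⟩ := exists_dual_certificate hn hφ hψ h hw
  have hc : Certificate φ ψc Z w β :=
    ⟨fun i => conj_eq_of_mem_subdiff (hβ₁ i), fun j => conj_eq_of_mem_subdiff (hβ₂ j)⟩
  have hle : dual φ ψ Z β ≤ dual φ ψ Z α := hα (Set.mem_univ β)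
  have hβ := hc.mem_dualDom hn h
  have hdom : α ∈ dualDom φ ψ Z := ne_bot_of_le_ne_bot hβ hle
  obtain ⟨h₁, h₂⟩ := (mem_dualDom_iff hn h).1 hdom
  have hgap : (primal φ ψ Z w : EReal) - dual φ ψ Z α ≤ 0 :=
    (EReal.sub_le_sub le_rfl hle).trans (hc.primal_sub_dual hn h).le
  rw [ERM.primal_sub_dual hn h hdom, ← EReal.coe_zero, EReal.coe_le_coe_iff] at hgap
  have hL : ∀ i, 0 ≤ fenchelGap φ (-(α i)) (inner ℝ (row Z i) w) :=
    fun i => fenchelGap_nonneg (h₁ i) _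
  have hP : ∀ j, 0 ≤ fenchelGap (ψc j) ((n : ℝ)⁻¹ * inner ℝ (col Z j) α) (w j) :=
    fun j => fenchelGap_nonneg (h₂ j) _
  have hn' : 0 < (n : ℝ)⁻¹ := by positivity
  have hsL := Finset.sum_nonneg fun i (_ : i ∈ Finset.univ) => hL i
  have hsP := Finset.sum_nonneg fun j (_ : j ∈ Finset.univ) => hP j
  have hL0 : ∑ i, fenchelGap φ (-(α i)) (inner ℝ (row Z i) w) = 0 := by
    have := mul_nonneg hn'.le hsL
    exact (mul_eq_zero.1 (le_antisymm (by linarith) this)).resolve_left hn'.ne'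
  have hP0 : ∑ j, fenchelGap (ψc j) ((n : ℝ)⁻¹ * inner ℝ (col Z j) α) (w j) = 0 := by
    have := mul_nonneg hn'.le hsL
    exact le_antisymm (by linarith) hsP
  exact ⟨fun i => conj_eq_of_fenchelGap_eq_zero (h₁ i)
      ((Finset.sum_eq_zero_iff_of_nonneg fun i _ => hL i).1 hL0 i (Finset.mem_univ i)),
    fun j => conj_eq_of_fenchelGap_eq_zero (h₂ j)
      ((Finset.sum_eq_zero_iff_of_nonneg fun j _ => hP j).1 hP0 j (Finset.mem_univ j))⟩

end Duality

/-! ### The duality gap of the old optimum in the new problem -/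

theorem inner_signed_row {n d : ℕ} (y : Fin n → ℝ) (X : Matrix (Fin n) (Fin d) ℝ) (i : Fin n)
    (w : EuclideanSpace ℝ (Fin d)) :
    inner ℝ (row (signed y X) i) w = ∑ j, y i * X i j * w j := by
  simp only [PiLp.inner_apply, row, signed, Matrix.diagonal_mul, RCLike.inner_apply, conj_trivial]
  exact Finset.sum_congr rfl fun j _ => by ring

theorem inner_signed_col {n d : ℕ} (y : Fin n → ℝ) (X : Matrix (Fin n) (Fin d) ℝ) (j : Fin d)
    (α : EuclideanSpace ℝ (Fin n)) :
    inner ℝ (col (signed y X) j) α = ∑ i, y i * X i j * α i := by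
  simp only [PiLp.inner_apply, col, signed, Matrix.diagonal_mul, RCLike.inner_apply, conj_trivial]
  exact Finset.sum_congr rfl fun i _ => by ring

theorem norm_row_sq {n d : ℕ} (X : Matrix (Fin n) (Fin d) ℝ) (i : Fin n) :
    ‖row X i‖ ^ 2 = ∑ j, X i j ^ 2 := by
  rw [EuclideanSpace.real_norm_sq_eq]; rfl

theorem norm_col_sq {n d : ℕ} (X : Matrix (Fin n) (Fin d) ℝ) (j : Fin d) :
    ‖col X j‖ ^ 2 = ∑ i, X i j ^ 2 := by
  rw [EuclideanSpace.real_norm_sq_eq]; rfl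

namespace Setup

variable {n d : ℕ} {S : Setup n d}

theorem Standing.label_sq (h : S.Standing) (i : Fin n) : S.y i ^ 2 = 1 := by
  rcases h.label i with e | e <;> simp [e]

theorem Standing.norm_row_signed (h : S.Standing) (X : Matrix (Fin n) (Fin d) ℝ) (i : Fin n) :
    ‖row (signed S.y X) i‖ = ‖row X i‖ := by
  rw [← sq_eq_sq₀ (norm_nonneg _) (norm_nonneg _), norm_row_sq, norm_row_sq]
  simp only [signed, Matrix.diagonal_mul, mul_pow, h.label_sq, one_mul]

theorem Standing.norm_col_signed (h : S.Standing) (X : Matrix (Fin n) (Fin d) ℝ) (j : Fin d) :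
    ‖col (signed S.y X) j‖ = ‖col X j‖ := by
  rw [← sq_eq_sq₀ (norm_nonneg _) (norm_nonneg _), norm_col_sq, norm_col_sq]
  simp only [signed, Matrix.diagonal_mul, mul_pow, h.label_sq, one_mul]

theorem Standing.row_new_eq (h : S.Standing) {i : Fin n} (hi : i ∉ S.M.image Prod.fst) :
    row S.Znew i = row S.Zold i := by
  simp only [row, Znew, Zold, signed, Matrix.diagonal_mul]
  congr 1; ext j
  rw [h.unmodified i j fun hm => hi (Finset.mem_image_of_mem Prod.fst hm)]

theorem Standing.col_new_eq (h : S.Standing) {j : Fin d} (hj : j ∉ S.M.image Prod.snd) :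
    col S.Znew j = col S.Zold j := by
  simp only [col, Znew, Zold, signed, Matrix.diagonal_mul]
  congr 1; ext i
  rw [h.unmodified i j fun hm => hj (Finset.mem_image_of_mem Prod.snd hm)]

theorem Standing.certificate_old (h : S.Standing) :
    Certificate S.φ S.ψc S.Zold S.wOld S.αOld :=
  certificate_of_optimal h.n_pos h.loss_convex h.penalty_convex h.decomposable h.wOld_opt
    h.αOld_opt

theorem Standing.certificate_new (h : S.Standing) {w : EuclideanSpace ℝ (Fin d)}
    {α : EuclideanSpace ℝ (Fin n)} (ho : S.NewOptimal w α) :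
    Certificate S.φ S.ψc S.Znew w α :=
  certificate_of_optimal h.n_pos h.loss_convex h.penalty_convex h.decomposable ho.1 ho.2

/-- The old pair has zero gap, so that gap may be subtracted. The terms φ*(−α̂_i) do not involve the
data, and unmodified rows and columns cancel. -/
theorem Standing.gap_eq (h : S.Standing) :
    S.gap = ((primal S.φ S.ψ S.Znew S.wOld : ℝ) : EReal) - dual S.φ S.ψ S.Znew S.αOld := by
  have hc := h.certificate_old
  have hn := h.n_pos
  have hlossfin : ∀ i, conj S.φ (-(S.αOld i)) ≠ ⊤ := fun i => by
    rw [hc.loss i]; exact EReal.coe_ne_top _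
  have holdfin : ∀ j, conj (S.ψc j) ((n : ℝ)⁻¹ * inner ℝ (col S.Zold j) S.αOld) ≠ ⊤ := fun j => by
    rw [hc.penalty j]; exact EReal.coe_ne_top _
  by_cases hdom : S.αOld ∈ dualDom S.φ S.ψ S.Znew
  · have hnewfin := ((mem_dualDom_iff hn h.decomposable).1 hdom).2
    have hold := hc.primal_sub_dual hn h.decomposable
    have hdomold := hc.mem_dualDom (ψ := S.ψ) hn h.decomposable
    rw [dual_eq_coe hn h.decomposable hdomold, ← EReal.coe_sub, ← EReal.coe_zero,
      EReal.coe_eq_coe_iff] at hold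
    rw [dual_eq_coe hn h.decomposable hdom, ← EReal.coe_sub, gap]
    have hP : ∑ i ∈ S.M.image Prod.fst,
        (S.φ (inner ℝ (row S.Znew i) S.wOld) - S.φ (inner ℝ (row S.Zold i) S.wOld)) =
        ∑ i, S.φ (inner ℝ (row S.Znew i) S.wOld) - ∑ i, S.φ (inner ℝ (row S.Zold i) S.wOld) := by
      rw [← Finset.sum_sub_distrib]
      refine Finset.sum_subset (Finset.subset_univ _) fun i _ hi => ?_
      rw [h.row_new_eq hi, sub_self]
    have hD : ∑ j ∈ S.M.image Prod.snd,
        ((conj (S.ψc j) ((n : ℝ)⁻¹ * inner ℝ (col S.Znew j) S.αOld)).toReal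
          - (conj (S.ψc j) ((n : ℝ)⁻¹ * inner ℝ (col S.Zold j) S.αOld)).toReal) =
        ∑ j, (conj (S.ψc j) ((n : ℝ)⁻¹ * inner ℝ (col S.Znew j) S.αOld)).toReal
          - ∑ j, (conj (S.ψc j) ((n : ℝ)⁻¹ * inner ℝ (col S.Zold j) S.αOld)).toReal := by
      rw [← Finset.sum_sub_distrib]
      refine Finset.sum_subset (Finset.subset_univ _) fun j _ hj => ?_
      rw [h.col_new_eq hj, sub_self]
    have hE : ∑ j ∈ S.M.image Prod.snd,
        (conj (S.ψc j) ((n : ℝ)⁻¹ * inner ℝ (col S.Znew j) S.αOld)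
          - conj (S.ψc j) ((n : ℝ)⁻¹ * inner ℝ (col S.Zold j) S.αOld)) =
        ((∑ j ∈ S.M.image Prod.snd,
        ((conj (S.ψc j) ((n : ℝ)⁻¹ * inner ℝ (col S.Znew j) S.αOld)).toReal
          - (conj (S.ψc j) ((n : ℝ)⁻¹ * inner ℝ (col S.Zold j) S.αOld)).toReal) : ℝ) : EReal) := by
      rw [ereal_coe_sum]
      refine Finset.sum_congr rfl fun j _ => ?_
      rw [EReal.coe_sub, EReal.coe_toReal (hnewfin j) (conj_ne_bot _ _),
        EReal.coe_toReal (holdfin j) (conj_ne_bot _ _)]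
    rw [hE, ← EReal.coe_add, EReal.coe_eq_coe_iff, hP, hD]
    unfold primal at hold ⊢
    linarith
  -- Now the new dual value is −∞. The loss conjugates at α̂ stay finite, so some ψ_j* is infinite
  -- at its new argument. Its old value was finite, hence column j is modified and `gap` has a
  -- summand `⊤` but none equal to `⊥`.
  · have hbot : dual S.φ S.ψ S.Znew S.αOld = ⊥ := not_not.1 hdom
    rw [hbot, EReal.coe_sub_bot, gap]
    rw [mem_dualDom_iff hn h.decomposable, not_and, not_forall] at hdom
    obtain ⟨j, hj⟩ := hdom hlossfin
    have hj' : conj (S.ψc j) ((n : ℝ)⁻¹ * inner ℝ (col S.Znew j) S.αOld) = ⊤ := not_not.1 hj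
    have hmem : j ∈ S.M.image Prod.snd := by
      by_contra hm
      exact holdfin j (by rw [← h.col_new_eq hm, hj'])
    have hne : ∀ k ∈ S.M.image Prod.snd,
        conj (S.ψc k) ((n : ℝ)⁻¹ * inner ℝ (col S.Znew k) S.αOld)
          - conj (S.ψc k) ((n : ℝ)⁻¹ * inner ℝ (col S.Zold k) S.αOld) ≠ ⊥ := fun k _ => by
      rw [sub_eq_add_neg, Ne, EReal.add_eq_bot_iff, EReal.neg_eq_bot_iff]
      exact not_or.2 ⟨conj_ne_bot _ _, holdfin k⟩
    have htop : ∑ k ∈ S.M.image Prod.snd,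
        (conj (S.ψc k) ((n : ℝ)⁻¹ * inner ℝ (col S.Znew k) S.αOld)
          - conj (S.ψc k) ((n : ℝ)⁻¹ * inner ℝ (col S.Zold k) S.αOld)) = ⊤ := by
      by_contra hcon
      refine (ereal_sum_ne_top_iff hne).1 hcon j hmem ?_
      rw [hj', hc.penalty j, EReal.top_sub_coe]
    rw [htop, EReal.coe_add_top]

end Setup

/-! ### Smooth losses -/

/-- The difference `f` of the two sides vanishes at `v`, and by the Lipschitz bound its derivative
has the sign of t − v; the mean value theorem concludes. -/
theorem SmoothLoss.le_quadratic {φ : ℝ → ℝ} {γ : ℝ} (h : SmoothLoss φ γ) (v x : ℝ) :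
    φ x ≤ φ v + deriv φ v * (x - v) + γ⁻¹ / 2 * (x - v) ^ 2 := by
  obtain ⟨-, hd, hL⟩ := h
  set f : ℝ → ℝ := fun t => φ v + deriv φ v * (t - v) + γ⁻¹ / 2 * (t - v) ^ 2 - φ t with hf
  have hder : ∀ t, HasDerivAt f (deriv φ v + γ⁻¹ * (t - v) - deriv φ t) t := by
    intro t
    have h1 : HasDerivAt (fun t : ℝ => t - v) 1 t := (hasDerivAt_id t).sub_const v
    have h2 := (((h1.const_mul (deriv φ v)).const_add (φ v)).add
      ((h1.pow 2).const_mul (γ⁻¹ / 2))).sub (hd t).hasDerivAt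
    refine h2.congr_deriv ?_
    simp
    ring
  have hfd : Differentiable ℝ f := fun t => (hder t).differentiableAt
  have hfv : f v = 0 := by simp [hf]
  suffices hs : 0 ≤ f x by
    simp only [hf] at hs; linarith
  rcases lt_trichotomy v x with hlt | heq | hlt
  · obtain ⟨c, hc, he⟩ := exists_deriv_eq_slope f hlt hfd.continuous.continuousOn
      hfd.differentiableOn
    rw [(hder c).deriv, hfv, sub_zero, eq_div_iff (by linarith)] at he
    have := (abs_le.1 (hL c v)).2
    rw [abs_of_pos (by linarith [hc.1])] at this
    rw [← he]
    exact mul_nonneg (by linarith) (by linarith)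
  · rw [← heq, hfv]
  · obtain ⟨c, hc, he⟩ := exists_deriv_eq_slope f hlt hfd.continuous.continuousOn
      hfd.differentiableOn
    rw [(hder c).deriv, hfv, zero_sub, eq_div_iff (by linarith)] at he
    have := (abs_le.1 (hL c v)).1
    rw [abs_of_neg (by linarith [hc.2])] at this
    have h3 : f x = -((deriv φ v + γ⁻¹ * (c - v) - deriv φ c) * (v - x)) := by linarith
    rw [h3, ← neg_mul]
    exact mul_nonneg (by linarith) (by linarith)

/-- The conjugate of a smooth function is strongly convex. -/
theorem SmoothLoss.le_fenchelGap {φ : ℝ → ℝ} {γ : ℝ} (h : SmoothLoss φ γ) {u : ℝ}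
    (hu : conj φ u ≠ ⊤) (v : ℝ) : γ / 2 * (u - deriv φ v) ^ 2 ≤ fenchelGap φ u v := by
  -- This point maximizes u x minus the quadratic upper bound for φ(x).
  have h1 := h.le_quadratic v (v + γ * (u - deriv φ v))
  have h2 := fenchelGap_nonneg hu (v + γ * (u - deriv φ v))
  unfold fenchelGap at h2 ⊢
  have hγ : γ ≠ 0 := h.1.ne'
  have h3 : γ⁻¹ / 2 * (v + γ * (u - deriv φ v) - v) ^ 2 = γ / 2 * (u - deriv φ v) ^ 2 := by
    field_simp
    ring
  rw [h3] at h1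
  nlinarith

theorem eq_deriv_of_mem_subdiff {φ : ℝ → ℝ} (hd : Differentiable ℝ φ) {g v : ℝ}
    (h : g ∈ subdiff (fun r => (φ r : EReal)) v) : g = deriv φ v := by
  have hmin : IsLocalMin (fun r => φ r - g * r) v := by
    refine Filter.Eventually.of_forall fun r => ?_
    have := mem_subdiff_coe.1 h r
    simp only [RCLike.inner_apply, conj_trivial] at this
    simp only
    linarith
  have h1 : HasDerivAt (fun r => φ r - g * r) (deriv φ v - g) v := by
    exact ((hd v).hasDerivAt.sub ((hasDerivAt_id v).const_mul g)).congr_deriv (by simp)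
  linarith [hmin.hasDerivAt_eq_zero h1]

/-! ### Monotonicity of subdifferentials -/

/-- Adding the two subgradient inequalities gives (x − g)(t − s) ≥ 0. Finiteness at `t` alone
suffices, since each inequality excludes one infinite value at `s`. -/
theorem subdiff_mono {f : ℝ → EReal} {s t g x : ℝ} (hb : f t ≠ ⊥) (ht : f t ≠ ⊤)
    (hx : x ∈ subdiff f t) (hg : g ∈ subdiff f s) (hst : s < t) : g ≤ x := by
  have h1 := hg t
  have h2 := hx s
  simp only [RCLike.inner_apply, conj_trivial] at h1 h2
  lift f t to ℝ using ⟨ht, hb⟩ with a ha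
  have hs1 : f s ≠ ⊤ := by
    intro h
    rw [h, EReal.top_add_coe] at h1
    exact EReal.coe_ne_top a (top_le_iff.1 h1)
  have hs2 : f s ≠ ⊥ := by
    intro h
    rw [h, ← EReal.coe_add] at h2
    exact EReal.coe_ne_bot _ (le_bot_iff.1 h2)
  lift f s to ℝ using ⟨hs1, hs2⟩ with b hb
  norm_cast at h1 h2
  by_contra hlt
  nlinarith [mul_pos (sub_pos.2 hst) (sub_pos.2 (not_le.1 hlt))]

theorem infOf_le {A : Set ℝ} {x : ℝ} (h : A.Nonempty → ∃ g ∈ A, g ≤ x) : infOf A ≤ x := by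
  unfold infOf
  split_ifs with hA
  · obtain ⟨g, hg, hgx⟩ := h hA
    exact (sInf_le (Set.mem_image_of_mem _ hg)).trans (EReal.coe_le_coe_iff.2 hgx)
  · exact bot_le

theorem le_supOf {A : Set ℝ} {x : ℝ} (h : A.Nonempty → ∃ g ∈ A, x ≤ g) : x ≤ supOf A := by
  unfold supOf
  split_ifs with hA
  · obtain ⟨g, hg, hgx⟩ := h hA
    exact (EReal.coe_le_coe_iff.2 hgx).trans (le_sSup (Set.mem_image_of_mem _ hg))
  · exact le_top

/-- A nonempty subdifferential forces τ to be real. At τ = t the element `x` itself serves; for τ <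
t monotonicity makes every element serve. -/
theorem exists_subdiffAt_le {f : ℝ → EReal} {t x : ℝ} {τ : EReal} (hb : f t ≠ ⊥) (ht : f t ≠ ⊤)
    (hx : x ∈ subdiff f t) (hτ : τ ≤ t) (hne : (subdiffAt f τ).Nonempty) :
    ∃ g ∈ subdiffAt f τ, g ≤ x := by
  obtain ⟨g, s, rfl, hg⟩ := hne
  rcases (EReal.coe_le_coe_iff.1 hτ).eq_or_lt with rfl | hlt
  · exact ⟨x, ⟨s, rfl, hx⟩, le_rfl⟩
  · exact ⟨g, ⟨s, rfl, hg⟩, subdiff_mono hb ht hx hg hlt⟩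

theorem exists_le_subdiffAt {f : ℝ → EReal} {t x : ℝ} {τ : EReal} (hb : f t ≠ ⊥) (ht : f t ≠ ⊤)
    (hx : x ∈ subdiff f t) (hτ : t ≤ τ) (hne : (subdiffAt f τ).Nonempty) :
    ∃ g ∈ subdiffAt f τ, x ≤ g := by
  obtain ⟨g, s, rfl, hg⟩ := hne
  have hst := EReal.coe_le_coe_iff.1 hτ
  rcases hst.eq_or_lt with rfl | hlt
  · exact ⟨x, ⟨t, rfl, hx⟩, le_rfl⟩
  · refine ⟨g, ⟨s, rfl, hg⟩, ?_⟩
    by_cases hs : f s = ⊤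
    · have h1 := hg t
      rw [hs, EReal.top_add_coe] at h1
      exact absurd (top_le_iff.1 h1) ht
    · have hsb : f s ≠ ⊥ := by
        intro hs'
        have h2 := hx s
        rw [hs'] at h2
        refine (EReal.add_eq_bot_iff.1 (le_bot_iff.1 h2)).elim hb (EReal.coe_ne_bot _)
      exact subdiff_mono hsb hs hg hx hlt

/-! ### Spheres around the old optima -/

/-- Reduces estimates to a finite gap: for G = +∞ the radius is infinite, because c > 0. -/
theorem coe_abs_le_esqrt {x c : ℝ} {G : EReal} (hc : 0 < c) (hbot : G ≠ ⊥)
    (h : ∀ g : ℝ, G = g → x ^ 2 ≤ c * g) : ((|x| : ℝ) : EReal) ≤ esqrt ((c : EReal) * G) := by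
  induction G with
  | bot => exact absurd rfl hbot
  | top => rw [EReal.coe_mul_top_of_pos hc]; simp [esqrt]
  | coe g =>
    rw [← EReal.coe_mul, esqrt, if_neg (EReal.coe_ne_top _), EReal.toReal_coe,
      EReal.coe_le_coe_iff]
    exact Real.abs_le_sqrt (h g rfl)

theorem ereal_sphere_bounds {a b : ℝ} {r : EReal} (h : ((|a - b| : ℝ) : EReal) ≤ r) :
    (a : EReal) - r ≤ b ∧ (b : EReal) ≤ a + r := by
  induction r with
  | bot => exact absurd (le_bot_iff.1 h) (EReal.coe_ne_bot _)
  | top => simp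
  | coe r =>
    have := abs_le.1 (EReal.coe_le_coe_iff.1 h)
    rw [← EReal.coe_sub, ← EReal.coe_add, EReal.coe_le_coe_iff, EReal.coe_le_coe_iff]
    constructor <;> linarith

theorem ereal_scaled_sphere {x k u : ℝ} {r : EReal} (hk : 0 ≤ k) (hu : |u| ≤ k * x)
    (hx : (x : EReal) ≤ r) : ((|u| : ℝ) : EReal) ≤ (k : EReal) * r :=
  (EReal.coe_le_coe_iff.2 hu).trans (by
    rw [EReal.coe_mul]
    exact mul_le_mul_of_nonneg_left hx (EReal.coe_nonneg.2 hk))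

namespace Setup

variable {n d : ℕ} {S : Setup n d}

theorem Standing.gap_ne_bot (h : S.Standing) : S.gap ≠ ⊥ := by
  rw [h.gap_eq]
  by_cases hdom : S.αOld ∈ dualDom S.φ S.ψ S.Znew
  · rw [dual_eq_coe h.n_pos h.decomposable hdom, ← EReal.coe_sub]
    exact EReal.coe_ne_bot _
  · rw [not_not.1 hdom, EReal.coe_sub_bot]
    exact top_ne_bot

theorem Standing.mem_dualDom_of_gap_eq_coe (h : S.Standing) {G : ℝ} (hG : S.gap = G) :
    S.αOld ∈ dualDom S.φ S.ψ S.Znew := by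
  intro hbot
  rw [h.gap_eq, hbot, EReal.coe_sub_bot] at hG
  exact EReal.coe_ne_top G hG.symm

/-- The mixed pair of new `w` and old α has gap at most G. Its penalty terms are dropped; each loss
term is at least γ/2 (α̂_i − α_i)², because −α_i is the derivative of φ at the new score. -/
theorem Standing.sphere_dual (h : S.Standing) (hs : SmoothLoss S.φ S.γ)
    {w : EuclideanSpace ℝ (Fin d)} {α : EuclideanSpace ℝ (Fin n)} (ho : S.NewOptimal w α) {G : ℝ}
    (hG : S.gap = G) : ‖S.αOld - α‖ ^ 2 ≤ 2 * n * S.γ⁻¹ * G := by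
  have hc := h.certificate_new ho
  have hdom := h.mem_dualDom_of_gap_eq_coe hG
  obtain ⟨h₁, h₂⟩ := (mem_dualDom_iff h.n_pos h.decomposable).1 hdom
  have hle : (primal S.φ S.ψ S.Znew w : EReal) - dual S.φ S.ψ S.Znew S.αOld ≤ G := by
    rw [← hG, h.gap_eq]
    exact EReal.sub_le_sub (EReal.coe_le_coe_iff.2 (ho.1 (Set.mem_univ S.wOld))) le_rfl
  rw [primal_sub_dual h.n_pos h.decomposable hdom, EReal.coe_le_coe_iff] at hle
  have hP := Finset.sum_nonneg fun j (_ : j ∈ Finset.univ) => fenchelGap_nonneg (h₂ j) (w j)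
  have hL : ∑ i, S.γ / 2 * (S.αOld i - α i) ^ 2 ≤
      ∑ i, fenchelGap S.φ (-(S.αOld i)) (inner ℝ (row S.Znew i) w) := by
    refine Finset.sum_le_sum fun i _ => ?_
    have h3 := hs.le_fenchelGap (h₁ i) (inner ℝ (row S.Znew i) w)
    rw [← eq_deriv_of_mem_subdiff hs.2.1 (mem_subdiff_of_conj_eq (hc.loss i))] at h3
    linarith [show (-S.αOld i - -α i) ^ 2 = (S.αOld i - α i) ^ 2 by ring]
  rw [← Finset.mul_sum] at hL
  have hn : (0 : ℝ) < n := by exact_mod_cast h.n_pos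
  have hγ := hs.1
  have h4 : (n : ℝ)⁻¹ * (S.γ / 2 * ∑ i, (S.αOld i - α i) ^ 2) ≤ G :=
    (mul_le_mul_of_nonneg_left hL (by positivity)).trans (by linarith)
  rw [EuclideanSpace.real_norm_sq_eq]
  simp only [PiLp.sub_apply]
  calc ∑ i, (S.αOld i - α i) ^ 2
      = 2 * n * S.γ⁻¹ * ((n : ℝ)⁻¹ * (S.γ / 2 * ∑ i, (S.αOld i - α i) ^ 2)) := by field_simp
    _ ≤ 2 * n * S.γ⁻¹ * G := mul_le_mul_of_nonneg_left h4 (by positivity)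

/-- Weak duality bounds P̃(ŵ) − P̃(w) by G. Expanding P̃ at `w` with the subgradients −α_i and
n⁻¹Z̃ᵀα, the linear terms cancel and only the quadratic term of strong convexity remains. -/
theorem Standing.sphere_primal (h : S.Standing) (hs : StronglyConvexPenalty S.ψ S.lam)
    {w : EuclideanSpace ℝ (Fin d)} {α : EuclideanSpace ℝ (Fin n)} (ho : S.NewOptimal w α) {G : ℝ}
    (hG : S.gap = G) : ‖S.wOld - w‖ ^ 2 ≤ 2 * S.lam⁻¹ * G := by
  have hc := h.certificate_new ho
  have hdom := h.mem_dualDom_of_gap_eq_coe hG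
  obtain ⟨h₁, h₂⟩ := (mem_dualDom_iff h.n_pos h.decomposable).1 hdom
  have hn : 0 < (n : ℝ)⁻¹ := by have := h.n_pos; positivity
  have hG' : primal S.φ S.ψ S.Znew S.wOld - primal S.φ S.ψ S.Znew w ≤ G := by
    have h3 := h.gap_eq
    have h4 := primal_sub_dual h.n_pos h.decomposable hdom w
    rw [hG, dual_eq_coe h.n_pos h.decomposable hdom, ← EReal.coe_sub, EReal.coe_eq_coe_iff] at h3
    rw [dual_eq_coe h.n_pos h.decomposable hdom, ← EReal.coe_sub, EReal.coe_eq_coe_iff] at h4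
    have hP := Finset.sum_nonneg fun j (_ : j ∈ Finset.univ) => fenchelGap_nonneg (h₂ j) (w j)
    have hL := mul_nonneg hn.le (Finset.sum_nonneg fun i (_ : i ∈ Finset.univ) =>
      fenchelGap_nonneg (h₁ i) (inner ℝ (row S.Znew i) w))
    linarith
  have hL : ∑ i, S.φ (inner ℝ (row S.Znew i) w) -
      ∑ i, α i * inner ℝ (row S.Znew i) (S.wOld - w) ≤
      ∑ i, S.φ (inner ℝ (row S.Znew i) S.wOld) := by
    rw [← Finset.sum_sub_distrib]
    refine Finset.sum_le_sum fun i _ => ?_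
    have := mem_subdiff_coe.1 (mem_subdiff_of_conj_eq (hc.loss i))
      (inner ℝ (row S.Znew i) S.wOld)
    rw [RCLike.inner_apply, conj_trivial, ← inner_sub_right] at this
    linarith
  have hψ : WithLp.toLp 2 (fun j => (n : ℝ)⁻¹ * inner ℝ (col S.Znew j) α) ∈
      subdiff (fun v => (S.ψ v : EReal)) w := by
    refine mem_subdiff_coe.2 fun v => ?_
    rw [h.decomposable, h.decomposable, PiLp.inner_apply, ← Finset.sum_add_distrib]
    exact Finset.sum_le_sum fun j _ =>
      mem_subdiff_coe.1 (mem_subdiff_of_conj_eq (hc.penalty j)) (v j)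
  have hP := hs.2.2 S.wOld w _ hψ
  have hcross : inner ℝ (WithLp.toLp 2 (fun j => (n : ℝ)⁻¹ * inner ℝ (col S.Znew j) α))
      (S.wOld - w) = (n : ℝ)⁻¹ * ∑ i, α i * inner ℝ (row S.Znew i) (S.wOld - w) := by
    rw [← sum_inner_row_col, PiLp.inner_apply, Finset.mul_sum]
    refine Finset.sum_congr rfl fun j _ => ?_
    simp only [RCLike.inner_apply, conj_trivial]
    ring
  rw [hcross] at hP
  have hL' := mul_le_mul_of_nonneg_left hL hn.le
  rw [mul_sub] at hL'
  unfold primal at hG'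
  have hfin : S.lam / 2 * ‖S.wOld - w‖ ^ 2 ≤ G := by linarith
  have hlam := hs.1
  calc ‖S.wOld - w‖ ^ 2 = 2 * S.lam⁻¹ * (S.lam / 2 * ‖S.wOld - w‖ ^ 2) := by field_simp
    _ ≤ 2 * S.lam⁻¹ * G := mul_le_mul_of_nonneg_left hfin (by positivity)

theorem abs_apply_le_norm {m : ℕ} (v : EuclideanSpace ℝ (Fin m)) (i : Fin m) : |v i| ≤ ‖v‖ := by
  simpa using PiLp.norm_apply_le v i

/-- The new w_j is a subgradient of ψ_j* at n⁻¹ z̃_{·j}ᵀα, which the dual ball and the dual domain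
confine to an interval. -/
theorem Standing.bounds_smooth (h : S.Standing) (hs : SmoothLoss S.φ S.γ)
    {w : EuclideanSpace ℝ (Fin d)} {α : EuclideanSpace ℝ (Fin n)} (ho : S.NewOptimal w α) :
    (∀ j, S.LDw j ≤ ((w j : ℝ) : EReal) ∧ ((w j : ℝ) : EReal) ≤ S.UDw j) ∧
      ∀ i, S.LDα i ≤ ((α i : ℝ) : EReal) ∧ ((α i : ℝ) : EReal) ≤ S.UDα i := by
  have hc := h.certificate_new ho
  have hdom : α ∈ dualDom S.φ S.ψ S.Znew := hc.mem_dualDom h.n_pos h.decomposable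
  have hn : (0 : ℝ) < n := by exact_mod_cast h.n_pos
  have hγ := hs.1
  refine ⟨fun j => ?_, fun i => ?_⟩
  · have hr : ((|(Real.sqrt n)⁻¹ * ‖S.αOld - α‖| : ℝ) : EReal) ≤
        esqrt (((2 * S.γ⁻¹ : ℝ) : EReal) * S.gap) := by
      refine coe_abs_le_esqrt (by positivity) h.gap_ne_bot fun G hG => ?_
      have := h.sphere_dual hs ho hG
      rw [mul_pow, inv_pow, Real.sq_sqrt hn.le, inv_mul_le_iff₀ hn]
      linarith
    have hdiff : |(n : ℝ)⁻¹ * inner ℝ (col S.Znew j) S.αOld -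
        (n : ℝ)⁻¹ * inner ℝ (col S.Znew j) α| ≤
        ‖col S.Xnew j‖ * |(Real.sqrt n)⁻¹ * ‖S.αOld - α‖| := by
      rw [← mul_sub, ← inner_sub_right, abs_mul, abs_mul, abs_norm,
        ← h.norm_col_signed, abs_of_pos (inv_pos.2 hn),
        abs_of_pos (inv_pos.2 (Real.sqrt_pos.2 hn))]
      -- The dual ball has squared radius 2nγ⁻¹G, so the exact factor would be n^(−1/2); the stated
      -- radius gives it up, and n ≥ 1 suffices.
      have h1 : (n : ℝ)⁻¹ ≤ (Real.sqrt n)⁻¹ := by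
        have h1n : (1 : ℝ) ≤ n := by exact_mod_cast h.n_pos
        refine inv_anti₀ (Real.sqrt_pos.2 hn) ?_
        rw [Real.sqrt_le_left (by linarith)]
        nlinarith
      calc (n : ℝ)⁻¹ * |inner ℝ (col S.Znew j) (S.αOld - α)|
          ≤ (Real.sqrt n)⁻¹ * (‖col S.Znew j‖ * ‖S.αOld - α‖) :=
            mul_le_mul h1 (abs_real_inner_le_norm _ _) (abs_nonneg _) (by positivity)
        _ = ‖col (signed S.y S.Xnew) j‖ * ((Real.sqrt n)⁻¹ * ‖S.αOld - α‖) := by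
            unfold Znew; ring
    have hb := ereal_sphere_bounds (ereal_scaled_sphere (norm_nonneg _) hdiff hr)
    have hsub := mem_subdiff_conj_of_conj_eq (hc.penalty j)
    have hfin : conj (S.ψc j) ((n : ℝ)⁻¹ * inner ℝ (col S.Znew j) α) ≠ ⊤ := by
      rw [hc.penalty j]; exact EReal.coe_ne_top _
    exact ⟨infOf_le (exists_subdiffAt_le (conj_ne_bot _ _) hfin hsub
        (max_le (iInf₂_le α hdom) hb.1)),
      le_supOf (exists_le_subdiffAt (conj_ne_bot _ _) hfin hsub
        (le_min (le_iSup₂ (f := fun (β : EuclideanSpace ℝ (Fin n))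
          (_ : β ∈ dualDom S.φ S.ψ S.Znew) =>
            (((n : ℝ)⁻¹ * inner ℝ (col S.Znew j) β : ℝ) : EReal)) α hdom) hb.2))⟩
  · have hr : ((|S.αOld i - α i| : ℝ) : EReal) ≤
        esqrt (((2 * (n : ℝ) * S.γ⁻¹ : ℝ) : EReal) * S.gap) := by
      refine coe_abs_le_esqrt (by positivity) h.gap_ne_bot fun G hG => ?_
      refine le_trans ?_ (h.sphere_dual hs ho hG)
      rw [← sq_abs]
      exact pow_le_pow_left₀ (abs_nonneg _) (abs_apply_le_norm (S.αOld - α) i) 2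
    have hb := ereal_sphere_bounds hr
    exact ⟨max_le (iInf₂_le α hdom) hb.1,
      le_min (le_iSup₂ (f := fun (β : EuclideanSpace ℝ (Fin n))
          (_ : β ∈ dualDom S.φ S.ψ S.Znew) => ((β i : ℝ) : EReal)) α hdom) hb.2⟩

/-- Since −α_i ∈ ∂φ at the new score, the sign change makes the upper end of the score interval
yield the lower bound for α_i. -/
theorem Standing.bounds_strong (h : S.Standing) (hs : StronglyConvexPenalty S.ψ S.lam)
    {w : EuclideanSpace ℝ (Fin d)} {α : EuclideanSpace ℝ (Fin n)} (ho : S.NewOptimal w α) :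
    (∀ j, S.LPw j ≤ ((w j : ℝ) : EReal) ∧ ((w j : ℝ) : EReal) ≤ S.UPw j) ∧
      ∀ i, S.LPα i ≤ ((α i : ℝ) : EReal) ∧ ((α i : ℝ) : EReal) ≤ S.UPα i := by
  have hc := h.certificate_new ho
  have hlam := hs.1
  refine ⟨fun j => ereal_sphere_bounds ?_, fun i => ?_⟩
  · refine coe_abs_le_esqrt (by positivity) h.gap_ne_bot fun G hG => ?_
    refine le_trans ?_ (h.sphere_primal hs ho hG)
    rw [← sq_abs]
    exact pow_le_pow_left₀ (abs_nonneg _) (abs_apply_le_norm (S.wOld - w) j) 2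
  · have hr : ((|‖S.wOld - w‖| : ℝ) : EReal) ≤ esqrt (((2 * S.lam⁻¹ : ℝ) : EReal) * S.gap) :=
      coe_abs_le_esqrt (by positivity) h.gap_ne_bot fun G hG => h.sphere_primal hs ho hG
    have hdiff : |inner ℝ (row S.Znew i) S.wOld - inner ℝ (row S.Znew i) w| ≤
        ‖row S.Xnew i‖ * |‖S.wOld - w‖| := by
      rw [← inner_sub_right, abs_norm, ← h.norm_row_signed]
      exact abs_real_inner_le_norm _ _
    have hb := ereal_sphere_bounds (ereal_scaled_sphere (norm_nonneg _) hdiff hr)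
    have hsub := mem_subdiff_of_conj_eq (hc.loss i)
    refine ⟨infOf_le fun hne => ?_, le_supOf fun hne => ?_⟩
    · obtain ⟨g, hg, hle⟩ := exists_le_subdiffAt (f := fun r => (S.φ r : EReal))
        (EReal.coe_ne_bot _) (EReal.coe_ne_top _) hsub hb.2 (Set.image_nonempty.1 hne)
      exact ⟨-g, ⟨g, hg, rfl⟩, by linarith⟩
    · obtain ⟨g, hg, hle⟩ := exists_subdiffAt_le (f := fun r => (S.φ r : EReal))
        (EReal.coe_ne_bot _) (EReal.coe_ne_top _) hsub hb.1 (Set.image_nonempty.1 hne)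
      exact ⟨-g, ⟨g, hg, rfl⟩, by linarith⟩

theorem Standing.bounds (h : S.Standing) {c : Case} (hs : S.Has c)
    {w : EuclideanSpace ℝ (Fin d)} {α : EuclideanSpace ℝ (Fin n)} (ho : S.NewOptimal w α) :
    (∀ j, S.lowerW c j ≤ ((w j : ℝ) : EReal) ∧ ((w j : ℝ) : EReal) ≤ S.upperW c j) ∧
      ∀ i, S.lowerα c i ≤ ((α i : ℝ) : EReal) ∧ ((α i : ℝ) : EReal) ≤ S.upperα c i := by
  cases c with
  | smooth => exact h.bounds_smooth hs ho
  | strong => exact h.bounds_strong hs ho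
  | both =>
    have h1 := h.bounds_smooth hs.1 ho
    have h2 := h.bounds_strong hs.2 ho
    exact ⟨fun j => ⟨max_le (h2.1 j).1 (h1.1 j).1, le_min (h2.1 j).2 (h1.1 j).2⟩,
      fun i => ⟨max_le (h2.2 i).1 (h1.2 i).1, le_min (h2.2 i).2 (h1.2 i).2⟩⟩

end Setup

/-! ### Expressions and their compilation -/

/-- Index registers used by compiled code: the target of a query, a register that stays `0`, and
the row and the column of the modified entry in a loop. -/
inductive Slot
  | target
  | origin
  | row
  | col

/-- Register 1 is left out: the loop in `accumulate` keeps its counter there. -/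
def Slot.reg : Slot → ℕ
  | .target => 0
  | .row => 2
  | .col => 3
  | .origin => 4

inductive Expr
  | const (m : ℕ)
  | scalar (s : ScalarName)
  | array (A : ArrayName) (i : Slot)
  | matrix (A : MatrixName) (i j : Slot)
  | work (k : ℕ) (i : Slot)
  | op (o : BinOp) (a b : Expr)
  | inv (a : Expr)
  | sqrt (a : Expr)
  | app (f : FunName) (i : Slot) (a : Expr)

namespace Expr

/-- Code that leaves the value of the expression in register `r` and preserves lower registers. -/
def compile : Expr → ℕ → Cmd
  | .const m, r => .const r m
  | .scalar s, r => .readScalar r s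
  | .array A i, r => .readArray r A i.reg
  | .matrix A i j, r => .readMatrix r A i.reg j.reg
  | .work k i, r => .load r k i.reg
  | .op o a b, r => .seq (a.compile r) (.seq (b.compile (r + 1)) (.op o r r (r + 1)))
  | .inv a, r => .seq (a.compile r) (.inv r r)
  | .sqrt a, r => .seq (a.compile r) (.sqrt r r)
  | .app f i a, r => .seq (a.compile r) (.apply r f i.reg r)

def eval (I : Input) (ρ : Slot → ℕ) (W : ℕ → ℕ → EReal) : Expr → EReal
  | .const m => m
  | .scalar s => I.scalar s
  | .array A i => I.array A (ρ i)
  | .matrix A i j => I.matrix A (ρ i) (ρ j)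
  | .work k i => W k (ρ i)
  | .op o a b => o.eval (a.eval I ρ W) (b.eval I ρ W)
  | .inv a => (a.eval I ρ W)⁻¹
  | .sqrt a => esqrt (a.eval I ρ W)
  | .app f i a => I.func f (ρ i) (a.eval I ρ W)

def cost : Expr → ℕ
  | .op _ a b => a.cost + (b.cost + 1)
  | .inv a => a.cost + 1
  | .sqrt a => a.cost + 1
  | .app _ _ a => a.cost + 1
  | _ => 1

/-- Preservation of registers below `r` drives the induction: `op` keeps its left value in `r` while
the right operand is computed from `r + 1` on. -/
theorem exec_compile (I : Input) (e : Expr) (r : ℕ) (σ : Memory) :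
    (exec I (e.compile r) σ).1.idx = σ.idx ∧
    (exec I (e.compile r) σ).1.work = σ.work ∧
    (exec I (e.compile r) σ).1.val r = e.eval I (fun s => σ.idx s.reg) σ.work ∧
    (∀ r' < r, (exec I (e.compile r) σ).1.val r' = σ.val r') ∧
    (exec I (e.compile r) σ).2 = e.cost := by
  induction e generalizing r σ with
  | const m =>
    exact ⟨rfl, rfl, Function.update_self .., fun r' h => Function.update_of_ne h.ne _ _, rfl⟩
  | scalar s =>
    exact ⟨rfl, rfl, Function.update_self .., fun r' h => Function.update_of_ne h.ne _ _, rfl⟩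
  | array A i =>
    exact ⟨rfl, rfl, Function.update_self .., fun r' h => Function.update_of_ne h.ne _ _, rfl⟩
  | matrix A i j =>
    exact ⟨rfl, rfl, Function.update_self .., fun r' h => Function.update_of_ne h.ne _ _, rfl⟩
  | work k i =>
    exact ⟨rfl, rfl, Function.update_self .., fun r' h => Function.update_of_ne h.ne _ _, rfl⟩
  | op o a b iha ihb =>
    obtain ⟨a1, a2, a3, a4, a5⟩ := iha r σ
    obtain ⟨b1, b2, b3, b4, b5⟩ := ihb (r + 1) (exec I (a.compile r) σ).1
    refine ⟨b1.trans a1, b2.trans a2, (Function.update_self ..).trans ?_, fun r' h => ?_, ?_⟩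
    · rw [b4 r (Nat.lt_succ_self r), a3, b3, a1, a2]
      rfl
    · exact (Function.update_of_ne h.ne _ _).trans ((b4 r' (h.trans (Nat.lt_succ_self r))).trans
        (a4 r' h))
    · exact congrArg₂ (· + ·) a5 (congrArg (· + 1) b5)
  | inv a iha =>
    obtain ⟨a1, a2, a3, a4, a5⟩ := iha r σ
    exact ⟨a1, a2, (Function.update_self ..).trans (congrArg _ a3),
      fun r' h => (Function.update_of_ne h.ne _ _).trans (a4 r' h), congrArg (· + 1) a5⟩
  | sqrt a iha =>
    obtain ⟨a1, a2, a3, a4, a5⟩ := iha r σ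
    exact ⟨a1, a2, (Function.update_self ..).trans (congrArg _ a3),
      fun r' h => (Function.update_of_ne h.ne _ _).trans (a4 r' h), congrArg (· + 1) a5⟩
  | app f i a iha =>
    obtain ⟨a1, a2, a3, a4, a5⟩ := iha r σ
    refine ⟨a1, a2, (Function.update_self ..).trans ?_,
      fun r' h => (Function.update_of_ne h.ne _ _).trans (a4 r' h), congrArg (· + 1) a5⟩
    rw [a1, a3]
    rfl

/-- The value of the expression does not depend on the writable array `k`. -/
def Avoids (e : Expr) (k : ℕ) : Prop :=
  ∀ I ρ W f, e.eval I ρ (Function.update W k f) = e.eval I ρ W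

end Expr

/-! ### Accumulation over the modified entries -/

/-- Contents of the index registers while the modified entry number `m` is processed. -/
def slotsAt (I : Input) (m : ℕ) : Slot → ℕ
  | .target => 0
  | .origin => 0
  | .row => I.modRow m
  | .col => I.modCol m

/-- One pass of `accumulate`. -/
def accumulatePass (k : ℕ) (t : Slot) (e : Expr) : Cmd :=
  .seq (.modRow 2 1) (.seq (.modCol 3 1)
    (.seq ((Expr.op .add (.work k t) e).compile 0) (.store k t.reg 0)))

/-- Adds the value of `e` to the cell `t` of the writable array `k`, for each modified entry. -/
def accumulate (k : ℕ) (t : Slot) (e : Expr) : Cmd := .forMod 1 (accumulatePass k t e)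

/-- The effect of `accumulate` on the writable arrays. -/
def accumulated (I : Input) (k : ℕ) (t : Slot) (e : Expr) (N : ℕ) (W : ℕ → ℕ → EReal) :
    ℕ → ℕ → EReal :=
  Function.update W k fun x => W k x +
    ∑ m ∈ Finset.range N, if slotsAt I m t = x then e.eval I (slotsAt I m) W else 0

/-- The five steps besides `e` are two index reads, a load, an addition and a store. -/
theorem exec_accumulatePass (I : Input) (k : ℕ) (t : Slot) (e : Expr) (m : ℕ) (σ : Memory)
    (h0 : σ.idx 0 = 0) (h4 : σ.idx 4 = 0) :
    (exec I (accumulatePass k t e) (σ.setIdx 1 m)).1.idx 0 = 0 ∧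
    (exec I (accumulatePass k t e) (σ.setIdx 1 m)).1.idx 4 = 0 ∧
    (exec I (accumulatePass k t e) (σ.setIdx 1 m)).1.work = Function.update σ.work k
      (Function.update (σ.work k) (slotsAt I m t)
        (σ.work k (slotsAt I m t) + e.eval I (slotsAt I m) σ.work)) ∧
    (exec I (accumulatePass k t e) (σ.setIdx 1 m)).2 = e.cost + 5 := by
  set τ := ((σ.setIdx 1 m).setIdx 2 (I.modRow m)).setIdx 3 (I.modCol m) with hτ
  have hidx : (fun s : Slot => τ.idx s.reg) = slotsAt I m := by
    funext s
    cases s <;> simp [hτ, Memory.setIdx, Slot.reg, slotsAt, h0, h4]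
  obtain ⟨a1, a2, a3, -, a5⟩ := Expr.exec_compile I (.op .add (.work k t) e) 0 τ
  rw [hidx] at a3
  have hwork : τ.work = σ.work := rfl
  set q := exec I ((Expr.op .add (.work k t) e).compile 0) τ with hq
  have hex : exec I (accumulatePass k t e) (σ.setIdx 1 m) =
      (q.1.setWork k (q.1.idx t.reg) (q.1.val 0), 1 + (1 + (q.2 + 1))) := by
    simp [accumulatePass, exec, hq, hτ, Memory.setIdx]
  rw [hex]
  refine ⟨?_, ?_, ?_, ?_⟩
  · change q.1.idx 0 = 0
    rw [a1]; simp [hτ, Memory.setIdx, h0]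
  · change q.1.idx 4 = 0
    rw [a1]; simp [hτ, Memory.setIdx, h4]
  · have ht : q.1.idx t.reg = slotsAt I m t := by rw [a1, ← hidx]
    simp only [Memory.setWork, a2, a3, ht, hwork]
    rfl
  · simp only [a5, Expr.cost]
    omega

/-- As `e` does not read the array being written, every pass evaluates it as if on the initial
arrays, and the passes add up to a plain sum. -/
theorem exec_accumulate (I : Input) {k : ℕ} {t : Slot} {e : Expr} (he : e.Avoids k) (σ : Memory)
    (h0 : σ.idx 0 = 0) (h4 : σ.idx 4 = 0) :
    (exec I (accumulate k t e) σ).1.idx 0 = 0 ∧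
    (exec I (accumulate k t e) σ).1.idx 4 = 0 ∧
    (exec I (accumulate k t e) σ).1.work = accumulated I k t e I.count σ.work ∧
    (exec I (accumulate k t e) σ).2 = 1 + I.count * (e.cost + 6) := by
  rw [accumulate, exec]
  induction I.count with
  | zero => simp [h0, h4, accumulated]
  | succ N ih =>
    obtain ⟨i1, i2, i3, i4⟩ := ih
    rw [List.range_succ, List.foldl_append, List.foldl_cons, List.foldl_nil]
    generalize hp : (List.range N).foldl _ _ = p at i1 i2 i3 i4 ⊢
    obtain ⟨b1, b2, b3, b4⟩ := exec_accumulatePass I k t e N p.1 i1 i2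
    refine ⟨b1, b2, b3.trans ?_, ?_⟩
    · rw [i3, accumulated, he, Function.update_idem, Function.update_self, accumulated]
      congr 1
      funext x
      rw [Finset.sum_range_succ, ← add_assoc]
      by_cases hx : slotsAt I N t = x
      · rw [← hx, Function.update_self, if_pos rfl]
      · rw [Function.update_of_ne (Ne.symm hx), if_neg hx, add_zero]
    · simp only [b4, i4]
      ring

/-- Performs the given accumulations one after the other. -/
def accumulateAll (L : List (ℕ × Slot × Expr)) : Cmd :=
  L.foldr (fun p c => .seq (accumulate p.1 p.2.1 p.2.2) c) .skip

theorem exec_accumulateAll (I : Input) {L : List (ℕ × Slot × Expr)}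
    (hL : ∀ p ∈ L, p.2.2.Avoids p.1) (σ : Memory) (h0 : σ.idx 0 = 0) (h4 : σ.idx 4 = 0) :
    (exec I (accumulateAll L) σ).1.idx 4 = 0 ∧
    (exec I (accumulateAll L) σ).1.work =
      L.foldl (fun W p => accumulated I p.1 p.2.1 p.2.2 I.count W) σ.work ∧
    (exec I (accumulateAll L) σ).2 ≤
      ((L.map fun p => p.2.2.cost + 7).sum + 1) * (I.count + 1) := by
  induction L generalizing σ with
  | nil => exact ⟨h4, rfl, by simp [accumulateAll, exec]⟩
  | cons p L ih =>
    obtain ⟨a1, a2, a3, a4⟩ := exec_accumulate I (t := p.2.1) (hL p List.mem_cons_self) σ h0 h4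
    obtain ⟨b1, b2, b3⟩ := ih (fun q hq => hL q (List.mem_cons_of_mem _ hq)) _ a1 a2
    refine ⟨b1, b2.trans (by rw [a3]; rfl), ?_⟩
    have : (exec I (accumulateAll (p :: L)) σ).2 = (exec I (accumulate p.1 p.2.1 p.2.2) σ).2 +
      (exec I (accumulateAll L) (exec I (accumulate p.1 p.2.1 p.2.2) σ).1).2 := rfl
    rw [this, a4, List.map_cons, List.sum_cons]
    nlinarith

/-! ### Answering a query by two expressions -/

/-- The second expression works from register 1 upwards and so keeps the first result. Only target
and origin are prescribed, because the row and column registers hold leftovers of the loops. -/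
theorem answers_compile (I : Input) (lo hi : Expr) (σ : Memory) (h4 : σ.idx 4 = 0) (target : ℕ)
    {L U : EReal} {T : ℕ}
    (hL : ∀ ρ : Slot → ℕ, ρ .target = target → ρ .origin = 0 → lo.eval I ρ σ.work = L)
    (hU : ∀ ρ : Slot → ℕ, ρ .target = target → ρ .origin = 0 → hi.eval I ρ σ.work = U)
    (hT : lo.cost + hi.cost ≤ T) :
    Answers I (.seq (lo.compile 0) (hi.compile 1)) σ target L U T := by
  obtain ⟨a1, a2, a3, -, a5⟩ := lo.exec_compile I 0 (σ.setIdx 0 target)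
  obtain ⟨-, -, b3, b4, b5⟩ := hi.exec_compile I 1 (exec I (lo.compile 0) (σ.setIdx 0 target)).1
  refine ⟨(b4 0 Nat.zero_lt_one).trans (a3.trans (hL _ ?_ ?_)), b3.trans ?_, ?_⟩
  · simp [Slot.reg, Memory.setIdx]
  · simp [Slot.reg, Memory.setIdx, h4]
  · rw [a1, a2]
    exact hU _ (by simp [Slot.reg, Memory.setIdx]) (by simp [Slot.reg, Memory.setIdx, h4])
  · exact le_trans (le_of_eq (congrArg₂ (· + ·) a5 b5)) hT

/-! ### The programs

Writable arrays: `0`, `1` hold the change of `zᵢ·ŵ` and of `‖xᵢ‖²`, `2`, `3` the change of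
`z_{·j}·α̂` and of `‖x_{·j}‖²`, `4`, `5` the change of `n` times the infimum and the supremum of
`n⁻¹ z_{·j}·α` over a box, `6`, `7` the number of modified entries in a row and in a column, and
`8`, `9` hold in cell `0` the two sums in the duality gap. -/

def signedEntry (A : MatrixName) : Expr :=
  .op .mul (.array .label .row) (.matrix A .row .col)

def entryChange : Expr :=
  .op .mul (.array .label .row) (.op .sub (.matrix .xNew .row .col) (.matrix .xOld .row .col))

def squareChange : Expr :=
  .op .sub (.op .mul (.matrix .xNew .row .col) (.matrix .xNew .row .col))
    (.op .mul (.matrix .xOld .row .col) (.matrix .xOld .row .col))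

/-- A linear function on an interval is extremal at the end points; taking `min` or `max` of both
products avoids a test of sign. -/
def boxExtremum (o : BinOp) (A : MatrixName) : Expr :=
  .op o (.op .mul (signedEntry A) (.scalar .dualLo)) (.op .mul (signedEntry A) (.scalar .dualHi))

/-- The inverse of the number of modified entries in the row lets a sum over entries count each row
once, with no search for duplicates. -/
def lossTerm : Expr :=
  .op .mul (.inv (.work 6 .row))
    (.op .sub (.app .loss .row (.op .add (.array .rowScore .row) (.work 0 .row)))
      (.app .loss .row (.array .rowScore .row)))

def penaltyTerm : Expr :=
  .op .mul (.inv (.work 7 .col))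
    (.op .sub
      (.app .conjPenalty .col (.op .mul (.inv (.scalar .size))
        (.op .add (.array .colCorr .col) (.work 2 .col))))
      (.app .conjPenalty .col (.op .mul (.inv (.scalar .size)) (.array .colCorr .col))))

/-- The accumulations of the first phase. -/
def plan : List (ℕ × Slot × Expr) :=
  [(0, .row, .op .mul entryChange (.array .oldW .col)),
   (1, .row, squareChange),
   (2, .col, .op .mul entryChange (.array .oldAlpha .row)),
   (3, .col, squareChange),
   (4, .col, .op .sub (boxExtremum .min .xNew) (boxExtremum .min .xOld)),
   (5, .col, .op .sub (boxExtremum .max .xNew) (boxExtremum .max .xOld)),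
   (6, .row, .const 1),
   (7, .col, .const 1),
   (8, .origin, lossTerm),
   (9, .origin, penaltyTerm)]

theorem plan_avoids : ∀ p ∈ plan, p.2.2.Avoids p.1 := by
  intro p hp
  simp only [plan, List.mem_cons, List.not_mem_nil, or_false] at hp
  rcases hp with rfl | rfl | rfl | rfl | rfl | rfl | rfl | rfl | rfl | rfl <;>
    intro I ρ W f <;>
    simp [Expr.eval, entryChange, squareChange, boxExtremum, signedEntry, lossTerm, penaltyTerm]

/-- The writable arrays after the first phase. -/
def planned (I : Input) : ℕ → ℕ → EReal :=
  plan.foldl (fun W p => accumulated I p.1 p.2.1 p.2.2 I.count W) fun _ _ => 0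

/-- Sum over the modified entries for which the slot `t` holds `x`. -/
def sumAt (I : Input) (t : Slot) (x : ℕ) (e : Expr) : EReal :=
  ∑ m ∈ Finset.range I.count, if slotsAt I m t = x then e.eval I (slotsAt I m) (planned I) else 0

/-- Each array is written by one accumulation and read only by later ones, so the summands may be
evaluated on the final arrays. -/
theorem planned_eq (I : Input) (x : ℕ) :
    planned I 0 x = sumAt I .row x (.op .mul entryChange (.array .oldW .col)) ∧
    planned I 1 x = sumAt I .row x squareChange ∧
    planned I 2 x = sumAt I .col x (.op .mul entryChange (.array .oldAlpha .row)) ∧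
    planned I 3 x = sumAt I .col x squareChange ∧
    planned I 4 x = sumAt I .col x
      (.op .sub (boxExtremum .min .xNew) (boxExtremum .min .xOld)) ∧
    planned I 5 x = sumAt I .col x
      (.op .sub (boxExtremum .max .xNew) (boxExtremum .max .xOld)) ∧
    planned I 6 x = sumAt I .row x (.const 1) ∧
    planned I 7 x = sumAt I .col x (.const 1) ∧
    planned I 8 x = sumAt I .origin x lossTerm ∧
    planned I 9 x = sumAt I .origin x penaltyTerm := by
  refine ⟨?_, ?_, ?_, ?_, ?_, ?_, ?_, ?_, ?_, ?_⟩ <;>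
    simp [planned, plan, accumulated, sumAt, Expr.eval, entryChange, squareChange, boxExtremum,
      signedEntry, lossTerm, penaltyTerm, Function.update]

def gapExpr : Expr :=
  .op .add (.op .mul (.inv (.scalar .size)) (.work 8 .origin)) (.work 9 .origin)

def radiusExpr (s : ScalarName) : Expr :=
  .sqrt (.op .mul (.op .mul (.const 2) (.inv (.scalar s))) gapExpr)

def dualRadiusExpr : Expr :=
  .sqrt (.op .mul (.op .mul (.op .mul (.const 2) (.scalar .size)) (.inv (.scalar .gamma))) gapExpr)

def rowScoreExpr : Expr := .op .add (.array .rowScore .target) (.work 0 .target)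

def rowNormExpr : Expr :=
  .sqrt (.op .add (.op .mul (.array .rowNorm .target) (.array .rowNorm .target)) (.work 1 .target))

def colCorrExpr : Expr :=
  .op .mul (.inv (.scalar .size)) (.op .add (.array .colCorr .target) (.work 2 .target))

def colNormExpr : Expr :=
  .sqrt (.op .add (.op .mul (.array .colNorm .target) (.array .colNorm .target)) (.work 3 .target))

def infCorrExpr : Store → Expr
  | .withNewExtrema => .array .newInfCorr .target
  | .oldOnly =>
    .op .add (.array .oldInfCorr .target) (.op .mul (.inv (.scalar .size)) (.work 4 .target))

def supCorrExpr : Store → Expr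
  | .withNewExtrema => .array .newSupCorr .target
  | .oldOnly =>
    .op .add (.array .oldSupCorr .target) (.op .mul (.inv (.scalar .size)) (.work 5 .target))

def infDualExpr : Store → Expr
  | .withNewExtrema => .array .newInfDual .target
  | .oldOnly => .scalar .dualLo

def supDualExpr : Store → Expr
  | .withNewExtrema => .array .newSupDual .target
  | .oldOnly => .scalar .dualHi

def LDwExpr (s : Store) : Expr :=
  .app .infSubConjPenalty .target
    (.op .max (infCorrExpr s) (.op .sub colCorrExpr (.op .mul colNormExpr (radiusExpr .gamma))))

def UDwExpr (s : Store) : Expr :=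
  .app .supSubConjPenalty .target
    (.op .min (supCorrExpr s) (.op .add colCorrExpr (.op .mul colNormExpr (radiusExpr .gamma))))

def LDαExpr (s : Store) : Expr :=
  .op .max (infDualExpr s) (.op .sub (.array .oldAlpha .target) dualRadiusExpr)

def UDαExpr (s : Store) : Expr :=
  .op .min (supDualExpr s) (.op .add (.array .oldAlpha .target) dualRadiusExpr)

def LPwExpr : Expr := .op .sub (.array .oldW .target) (radiusExpr .lambda)

def UPwExpr : Expr := .op .add (.array .oldW .target) (radiusExpr .lambda)

def LPαExpr : Expr :=
  .app .infNegSubLoss .target (.op .add rowScoreExpr (.op .mul rowNormExpr (radiusExpr .lambda)))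

def UPαExpr : Expr :=
  .app .supNegSubLoss .target (.op .sub rowScoreExpr (.op .mul rowNormExpr (radiusExpr .lambda)))

def lowerWExpr (s : Store) : Case → Expr
  | .smooth => LDwExpr s
  | .strong => LPwExpr
  | .both => .op .max LPwExpr (LDwExpr s)

def upperWExpr (s : Store) : Case → Expr
  | .smooth => UDwExpr s
  | .strong => UPwExpr
  | .both => .op .min UPwExpr (UDwExpr s)

def lowerαExpr (s : Store) : Case → Expr
  | .smooth => LDαExpr s
  | .strong => LPαExpr
  | .both => .op .max LPαExpr (LDαExpr s)

def upperαExpr (s : Store) : Case → Expr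
  | .smooth => UDαExpr s
  | .strong => UPαExpr
  | .both => .op .min UPαExpr (UDαExpr s)

/-! ### Step counts, and sums over the modified entries -/

theorem cost_queries_le (s : Store) (c : Case) :
    (lowerWExpr s c).cost + (upperWExpr s c).cost ≤ 200 ∧
      (lowerαExpr s c).cost + (upperαExpr s c).cost ≤ 200 := by
  cases s <;> cases c <;>
    simp [lowerWExpr, upperWExpr, lowerαExpr, upperαExpr, LDwExpr, UDwExpr,
      LDαExpr, UDαExpr, LPwExpr, UPwExpr, LPαExpr, UPαExpr, infCorrExpr, supCorrExpr, infDualExpr,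
      supDualExpr, colCorrExpr, colNormExpr, rowScoreExpr, rowNormExpr, radiusExpr, dualRadiusExpr,
      gapExpr, Expr.cost]

theorem cost_plan_le : (plan.map fun p => p.2.2.cost + 7).sum + 1 ≤ 200 := by
  simp [plan, entryChange, squareChange, boxExtremum, signedEntry, lossTerm, penaltyTerm,
    Expr.cost]

/-- Terms outside `M` vanish, so the modified entries of a row already give the full row sum. -/
theorem sum_mem_fst {n d : ℕ} {R : Type*} [AddCommMonoid R] (M : Finset (Fin n × Fin d))
    (f : Fin n × Fin d → R) (i : Fin n) (hf : ∀ j, (i, j) ∉ M → f (i, j) = 0) :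
    ∑ p ∈ M, (if (p.1 : ℕ) = i then f p else 0) = ∑ j, f (i, j) := by
  have hz : ∀ p ∈ Finset.univ, p ∉ M → (if (p.1 : ℕ) = i then f p else 0) = 0 := by
    rintro ⟨k, j⟩ _ hp
    split_ifs with hk
    · obtain rfl : k = i := Fin.ext hk
      exact hf j hp
    · rfl
  rw [Finset.sum_subset (Finset.subset_univ M) hz, Fintype.sum_prod_type, Finset.sum_eq_single i]
  · simp
  · intro k _ hk
    simp [Fin.val_inj, hk]
  · simp

theorem sum_mem_snd {n d : ℕ} {R : Type*} [AddCommMonoid R] (M : Finset (Fin n × Fin d))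
    (f : Fin n × Fin d → R) (j : Fin d) (hf : ∀ i, (i, j) ∉ M → f (i, j) = 0) :
    ∑ p ∈ M, (if (p.2 : ℕ) = j then f p else 0) = ∑ i, f (i, j) := by
  have hz : ∀ p ∈ Finset.univ, p ∉ M → (if (p.2 : ℕ) = j then f p else 0) = 0 := by
    rintro ⟨i, k⟩ _ hp
    split_ifs with hk
    · obtain rfl : k = j := Fin.ext hk
      exact hf i hp
    · rfl
  rw [Finset.sum_subset (Finset.subset_univ M) hz, Fintype.sum_prod_type]
  refine Finset.sum_congr rfl fun i _ => ?_
  rw [Finset.sum_eq_single j]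
  · simp
  · intro k _ hk
    simp [Fin.val_inj, hk]
  · simp

/-- Summing over a set with weights one over the size of the fibre gives the sum over the image. -/
theorem sum_inv_fibre_card {A B : Type*} [DecidableEq B] (M : Finset A) (f : A → B)
    (v : B → EReal) :
    ∑ p ∈ M, (∑ q ∈ M, if f q = f p then (1 : EReal) else 0)⁻¹ * v (f p) =
      ∑ b ∈ M.image f, v b := by
  rw [← Finset.sum_fiberwise_of_maps_to (fun p hp => Finset.mem_image_of_mem f hp)]
  refine Finset.sum_congr rfl fun b hb => ?_
  set c := (M.filter fun q => f q = b).card with hc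
  have hcpos : (c : ℝ) ≠ 0 := by
    obtain ⟨p, hp, rfl⟩ := Finset.mem_image.1 hb
    have hmem : p ∈ M.filter fun q => f q = f p := Finset.mem_filter.2 ⟨hp, rfl⟩
    exact Nat.cast_ne_zero.2 (Finset.card_pos.2 ⟨p, hmem⟩).ne'
  have hcount : ∑ q ∈ M, (if f q = b then (1 : EReal) else 0) = ((c : ℝ) : EReal) := by
    rw [← Finset.sum_filter, Finset.sum_const, EReal.nsmul_eq_mul, mul_one, EReal.coe_natCast]
  rw [Finset.sum_congr rfl (g := fun _ => ((c : ℝ) : EReal)⁻¹ * v b) fun p hp => by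
    rw [(Finset.mem_filter.1 hp).2, hcount]]
  -- Associativity cancels c against its inverse before `v b` is touched, so infinite values are
  -- allowed.
  rw [Finset.sum_const, EReal.nsmul_eq_mul, ← mul_assoc, ← EReal.coe_natCast, ← EReal.coe_inv,
    ← EReal.coe_mul, mul_inv_cancel₀ hcpos, EReal.coe_one, one_mul]

theorem esqrt_coe (x : ℝ) : esqrt (x : EReal) = ((Real.sqrt x : ℝ) : EReal) := by
  rw [esqrt, if_neg (EReal.coe_ne_top _), EReal.toReal_coe]

theorem toArray_val {m : ℕ} (f : Fin m → EReal) (k : Fin m) : toArray f k = f k := by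
  simp [toArray]

/-- Contents of the index registers while a modified entry is processed. -/
def entrySlots {n d : ℕ} (p : Fin n × Fin d) : Slot → ℕ
  | .target => 0
  | .origin => 0
  | .row => p.1
  | .col => p.2

/-! ### Contents of the writable arrays after the first phase -/

namespace Setup

variable {n d : ℕ} {S : Setup n d}

/-- Without repetitions in `l`, list positions correspond bijectively to the elements of `S.M`. -/
theorem sum_range_count (S : Setup n d) (s : Store) {l : List (Fin n × Fin d)} (hl : l.Nodup)
    (hM : l.toFinset = S.M) (g : (Slot → ℕ) → EReal) :
    ∑ m ∈ Finset.range (S.input s l).count, g (slotsAt (S.input s l) m) =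
      ∑ p ∈ S.M, g (entrySlots p) := by
  rw [← hM, List.sum_toFinset _ hl, ← Fin.sum_univ_fun_getElem, Finset.sum_range]
  refine Finset.sum_congr rfl fun m _ => congrArg g ?_
  have hm : (m : ℕ) < l.length := m.2
  funext t
  cases t <;> simp [slotsAt, entrySlots, input, hm]

theorem sumAt_eq (S : Setup n d) (s : Store) {l : List (Fin n × Fin d)} (hl : l.Nodup)
    (hM : l.toFinset = S.M) (t : Slot) (x : ℕ) (e : Expr) :
    sumAt (S.input s l) t x e = ∑ p ∈ S.M, if entrySlots p t = x then
      e.eval (S.input s l) (entrySlots p) (planned (S.input s l)) else 0 :=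
  S.sum_range_count s hl hM fun ρ => if ρ t = x then
    e.eval (S.input s l) ρ (planned (S.input s l)) else 0

theorem matrixOf_xNew (S : Setup n d) (i : Fin n) (j : Fin d) :
    S.matrixOf .xNew i j = ((S.Xnew i j : ℝ) : EReal) := by
  simp [matrixOf]

theorem matrixOf_xOld (S : Setup n d) (i : Fin n) (j : Fin d) :
    S.matrixOf .xOld i j = ((S.Xold i j : ℝ) : EReal) := by
  simp [matrixOf]

theorem planned_score (h : S.Standing) (s : Store) {l : List (Fin n × Fin d)} (hl : l.Nodup)
    (hM : l.toFinset = S.M) (i : Fin n) :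
    ((inner ℝ (row S.Zold i) S.wOld : ℝ) : EReal) + planned (S.input s l) 0 i =
      ((inner ℝ (row S.Znew i) S.wOld : ℝ) : EReal) := by
  rw [(planned_eq _ _).1, S.sumAt_eq s hl hM]
  have : ∀ p : Fin n × Fin d, (Expr.op .mul entryChange (.array .oldW .col)).eval (S.input s l)
      (entrySlots p) (planned (S.input s l)) =
      ((S.y p.1 * (S.Xnew p.1 p.2 - S.Xold p.1 p.2) * S.wOld p.2 : ℝ) : EReal) := fun p => by
    simp [Expr.eval, entryChange, BinOp.eval, input, arrayOf, entrySlots, matrixOf_xNew,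
      matrixOf_xOld, toArray_val]
  simp only [this]
  refine (congrArg _ (sum_mem_fst S.M _ i fun j hj => ?_)).trans ?_
  · simp [h.unmodified i j hj]
  · rw [← ereal_coe_sum, ← EReal.coe_add, EReal.coe_eq_coe_iff, Zold, Znew, inner_signed_row,
      inner_signed_row, ← Finset.sum_add_distrib]
    exact Finset.sum_congr rfl fun j _ => by ring

theorem planned_corr (h : S.Standing) (s : Store) {l : List (Fin n × Fin d)} (hl : l.Nodup)
    (hM : l.toFinset = S.M) (j : Fin d) :
    ((inner ℝ (col S.Zold j) S.αOld : ℝ) : EReal) + planned (S.input s l) 2 j =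
      ((inner ℝ (col S.Znew j) S.αOld : ℝ) : EReal) := by
  rw [(planned_eq _ _).2.2.1, S.sumAt_eq s hl hM]
  have : ∀ p : Fin n × Fin d, (Expr.op .mul entryChange (.array .oldAlpha .row)).eval
      (S.input s l) (entrySlots p) (planned (S.input s l)) =
      ((S.y p.1 * (S.Xnew p.1 p.2 - S.Xold p.1 p.2) * S.αOld p.1 : ℝ) : EReal) := fun p => by
    simp [Expr.eval, entryChange, BinOp.eval, input, arrayOf, entrySlots, matrixOf_xNew,
      matrixOf_xOld, toArray_val]
  simp only [this]
  refine (congrArg _ (sum_mem_snd S.M _ j fun i hi => ?_)).trans ?_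
  · simp [h.unmodified i j hi]
  · rw [← ereal_coe_sum, ← EReal.coe_add, EReal.coe_eq_coe_iff, Zold, Znew, inner_signed_col,
      inner_signed_col, ← Finset.sum_add_distrib]
    exact Finset.sum_congr rfl fun i _ => by ring

theorem eval_squareChange (S : Setup n d) (s : Store) (l : List (Fin n × Fin d))
    (W : ℕ → ℕ → EReal) (p : Fin n × Fin d) :
    squareChange.eval (S.input s l) (entrySlots p) W =
      ((S.Xnew p.1 p.2 ^ 2 - S.Xold p.1 p.2 ^ 2 : ℝ) : EReal) := by
  simp [Expr.eval, squareChange, BinOp.eval, input, entrySlots, matrixOf_xNew, matrixOf_xOld,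
    pow_two]

/-- Squared norms, unlike norms, change additively with the entries; the root is taken only in the
query. -/
theorem planned_rowNorm (h : S.Standing) (s : Store) {l : List (Fin n × Fin d)} (hl : l.Nodup)
    (hM : l.toFinset = S.M) (i : Fin n) :
    esqrt (((‖row S.Xold i‖ : ℝ) : EReal) * ((‖row S.Xold i‖ : ℝ) : EReal)
      + planned (S.input s l) 1 i) = ((‖row S.Xnew i‖ : ℝ) : EReal) := by
  rw [(planned_eq _ _).2.1, S.sumAt_eq s hl hM]
  simp only [eval_squareChange]
  rw [show ∑ p ∈ S.M, (if entrySlots p .row = i then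
      ((S.Xnew p.1 p.2 ^ 2 - S.Xold p.1 p.2 ^ 2 : ℝ) : EReal) else 0) = _ from
    sum_mem_fst S.M (fun p => ((S.Xnew p.1 p.2 ^ 2 - S.Xold p.1 p.2 ^ 2 : ℝ) : EReal)) i
      fun j hj => by simp [h.unmodified i j hj]]
  rw [← ereal_coe_sum, ← EReal.coe_mul, ← EReal.coe_add, esqrt_coe, EReal.coe_eq_coe_iff,
    Finset.sum_sub_distrib, ← norm_row_sq, ← norm_row_sq, ← pow_two, add_sub_cancel,
    Real.sqrt_sq (norm_nonneg _)]

theorem planned_colNorm (h : S.Standing) (s : Store) {l : List (Fin n × Fin d)} (hl : l.Nodup)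
    (hM : l.toFinset = S.M) (j : Fin d) :
    esqrt (((‖col S.Xold j‖ : ℝ) : EReal) * ((‖col S.Xold j‖ : ℝ) : EReal)
      + planned (S.input s l) 3 j) = ((‖col S.Xnew j‖ : ℝ) : EReal) := by
  rw [(planned_eq _ _).2.2.2.1, S.sumAt_eq s hl hM]
  simp only [eval_squareChange]
  rw [show ∑ p ∈ S.M, (if entrySlots p .col = j then
      ((S.Xnew p.1 p.2 ^ 2 - S.Xold p.1 p.2 ^ 2 : ℝ) : EReal) else 0) = _ from
    sum_mem_snd S.M (fun p => ((S.Xnew p.1 p.2 ^ 2 - S.Xold p.1 p.2 ^ 2 : ℝ) : EReal)) j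
      fun i hi => by simp [h.unmodified i j hi]]
  rw [← ereal_coe_sum, ← EReal.coe_mul, ← EReal.coe_add, esqrt_coe, EReal.coe_eq_coe_iff,
    Finset.sum_sub_distrib, ← norm_col_sq S.Xnew, ← norm_col_sq S.Xold, ← pow_two, add_sub_cancel,
    Real.sqrt_sq (norm_nonneg _)]

theorem planned_rowCount (S : Setup n d) (s : Store) {l : List (Fin n × Fin d)} (hl : l.Nodup)
    (hM : l.toFinset = S.M) (i : Fin n) :
    planned (S.input s l) 6 i = ∑ q ∈ S.M, if q.1 = i then (1 : EReal) else 0 := by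
  rw [(planned_eq _ _).2.2.2.2.2.2.1, S.sumAt_eq s hl hM]
  simp [Expr.eval, entrySlots, Fin.val_inj]

theorem planned_colCount (S : Setup n d) (s : Store) {l : List (Fin n × Fin d)} (hl : l.Nodup)
    (hM : l.toFinset = S.M) (j : Fin d) :
    planned (S.input s l) 7 j = ∑ q ∈ S.M, if q.2 = j then (1 : EReal) else 0 := by
  rw [(planned_eq _ _).2.2.2.2.2.2.2.1, S.sumAt_eq s hl hM]
  simp [Expr.eval, entrySlots, Fin.val_inj]

theorem eval_lossTerm (h : S.Standing) (s : Store) {l : List (Fin n × Fin d)} (hl : l.Nodup)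
    (hM : l.toFinset = S.M) (p : Fin n × Fin d) :
    lossTerm.eval (S.input s l) (entrySlots p) (planned (S.input s l)) =
      (∑ q ∈ S.M, if q.1 = p.1 then (1 : EReal) else 0)⁻¹ *
        ((S.φ (inner ℝ (row S.Znew p.1) S.wOld) - S.φ (inner ℝ (row S.Zold p.1) S.wOld) : ℝ) :
          EReal) := by
  have h0 := planned_score h s hl hM p.1
  have h6 := planned_rowCount S s hl hM p.1
  have hA : (S.input s l).array .rowScore (p.1 : ℕ) =
      ((inner ℝ (row S.Zold p.1) S.wOld : ℝ) : EReal) := by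
    simp [input, arrayOf, toArray_val]
  simp only [lossTerm, Expr.eval, BinOp.eval, entrySlots, hA, h0, h6]
  simp [input, funcOf]

theorem eval_penaltyTerm (h : S.Standing) (s : Store) {l : List (Fin n × Fin d)} (hl : l.Nodup)
    (hM : l.toFinset = S.M) (p : Fin n × Fin d) :
    penaltyTerm.eval (S.input s l) (entrySlots p) (planned (S.input s l)) =
      (∑ q ∈ S.M, if q.2 = p.2 then (1 : EReal) else 0)⁻¹ *
        (conj (S.ψc p.2) ((n : ℝ)⁻¹ * inner ℝ (col S.Znew p.2) S.αOld)
          - conj (S.ψc p.2) ((n : ℝ)⁻¹ * inner ℝ (col S.Zold p.2) S.αOld)) := by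
  have h0 := planned_corr h s hl hM p.2
  have h6 := planned_colCount S s hl hM p.2
  have hA : (S.input s l).array .colCorr (p.2 : ℕ) =
      ((inner ℝ (col S.Zold p.2) S.αOld : ℝ) : EReal) := by
    simp [input, arrayOf, toArray_val]
  have hn : (S.input s l).scalar .size = ((n : ℝ) : EReal) := rfl
  simp only [penaltyTerm, Expr.eval, BinOp.eval, entrySlots, hA, h0, h6, hn, ← EReal.coe_inv,
    ← EReal.coe_mul]
  simp only [input, funcOf, toArray_val, EReal.toReal_coe]

theorem eval_gapExpr (h : S.Standing) (s : Store) {l : List (Fin n × Fin d)} (hl : l.Nodup)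
    (hM : l.toFinset = S.M) {ρ : Slot → ℕ} (hρ : ρ .origin = 0) :
    gapExpr.eval (S.input s l) ρ (planned (S.input s l)) = S.gap := by
  have hn : (S.input s l).scalar .size = ((n : ℝ) : EReal) := rfl
  simp only [gapExpr, Expr.eval, BinOp.eval, hρ, hn, (planned_eq _ _).2.2.2.2.2.2.2.2.1,
    (planned_eq _ _).2.2.2.2.2.2.2.2.2, S.sumAt_eq s hl hM, eval_lossTerm h s hl hM,
    eval_penaltyTerm h s hl hM]
  simp only [entrySlots, if_true]
  rw [sum_inv_fibre_card S.M Prod.fst fun i =>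
      ((S.φ (inner ℝ (row S.Znew i) S.wOld) - S.φ (inner ℝ (row S.Zold i) S.wOld) : ℝ) : EReal),
    sum_inv_fibre_card S.M Prod.snd fun j =>
      conj (S.ψc j) ((n : ℝ)⁻¹ * inner ℝ (col S.Znew j) S.αOld)
          - conj (S.ψc j) ((n : ℝ)⁻¹ * inner ℝ (col S.Zold j) S.αOld),
    ← ereal_coe_sum, ← EReal.coe_inv, ← EReal.coe_mul, gap]

end Setup

/-! ### Extrema of linear functions over a box -/

theorem iSup_coe_neg {ι : Type*} (f : ι → ℝ) :
    ⨆ i, ((-f i : ℝ) : EReal) = -⨅ i, (f i : EReal) := by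
  refine le_antisymm (iSup_le fun i => ?_) (EReal.neg_le.1 (le_iInf fun i => EReal.neg_le.1 ?_))
  · rw [EReal.coe_neg, EReal.neg_le_neg_iff]
    exact iInf_le (fun i => (f i : EReal)) i
  · rw [← EReal.coe_neg]
    exact le_iSup (fun i => ((-f i : ℝ) : EReal)) i

theorem iSup_coe_mul_of_pos {ι : Type*} (f : ι → ℝ) {c : ℝ} (hc : 0 < c) :
    ⨆ i, ((c * f i : ℝ) : EReal) = c * ⨆ i, (f i : EReal) := by
  have hc' : (0 : EReal) < c := EReal.coe_pos.2 hc
  refine le_antisymm (iSup_le fun i => ?_) ?_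
  · rw [EReal.coe_mul]
    exact mul_le_mul_of_nonneg_left (le_iSup (fun i => (f i : EReal)) i) hc'.le
  · rw [mul_comm]
    refine (EReal.le_div_iff_mul_le hc' (EReal.coe_ne_top c)).1 (iSup_le fun i => ?_)
    rw [EReal.le_div_iff_mul_le hc' (EReal.coe_ne_top c), ← EReal.coe_mul, mul_comm]
    exact le_iSup (fun i => ((c * f i : ℝ) : EReal)) i

/-- Multiplication by c preserves or reverses order according to its sign, and `max` selects the
right end in both cases; c = 0 relies on 0 · ∞ = 0. -/
theorem iSup_coe_mul {ι : Type*} [Nonempty ι] (f : ι → ℝ) (c : ℝ) :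
    ⨆ i, ((c * f i : ℝ) : EReal) = max (c * ⨅ i, (f i : EReal)) (c * ⨆ i, (f i : EReal)) := by
  have hle : ⨅ i, (f i : EReal) ≤ ⨆ i, (f i : EReal) := iInf_le_iSup
  rcases lt_trichotomy c 0 with hc | rfl | hc
  · have h1 : ⨆ i, ((c * f i : ℝ) : EReal) = c * ⨅ i, (f i : EReal) := by
      have h2 := iSup_coe_mul_of_pos (fun i => -f i) (neg_pos.2 hc)
      rw [iSup_coe_neg, EReal.coe_neg, EReal.neg_mul, mul_neg, neg_neg] at h2
      simpa using h2
    rw [h1, max_eq_left]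
    have h3 := mul_le_mul_of_nonneg_left hle (EReal.coe_nonneg.2 (neg_pos.2 hc).le)
    rwa [EReal.coe_neg, EReal.neg_mul, EReal.neg_mul, EReal.neg_le_neg_iff] at h3
  · simp
  · rw [iSup_coe_mul_of_pos f hc, max_eq_right]
    exact mul_le_mul_of_nonneg_left hle (EReal.coe_nonneg.2 hc.le)

theorem iInf_coe_mul {ι : Type*} [Nonempty ι] (f : ι → ℝ) (c : ℝ) :
    ⨅ i, ((c * f i : ℝ) : EReal) = min (c * ⨅ i, (f i : EReal)) (c * ⨆ i, (f i : EReal)) := by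
  have h1 := iSup_coe_mul f (-c)
  rw [EReal.coe_neg, EReal.neg_mul, EReal.neg_mul, EReal.max_neg_neg] at h1
  simp only [neg_mul] at h1
  rwa [iSup_coe_neg, neg_inj] at h1

/-- The sum ⊤ + ⊥ is ⊥, so negation commutes with addition only if such sums are excluded. -/
theorem ereal_sum_neg {ι : Type*} {s : Finset ι} {f : ι → EReal} (h : ∀ i ∈ s, f i ≠ ⊥) :
    ∑ i ∈ s, -f i = -∑ i ∈ s, f i := by
  classical
  induction s using Finset.induction_on with
  | empty => simp
  | insert a s ha ih =>
    simp only [Finset.mem_insert, forall_eq_or_imp] at h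
    rw [Finset.sum_insert ha, Finset.sum_insert ha, ih h.2,
      EReal.neg_add (Or.inl h.1) (Or.inr (ereal_sum_ne_bot h.2)), sub_eq_add_neg]

/-- The infimum of a separable sum is the sum of the infima. -/
theorem iInf_sum_pi {ι A : Type*} [Fintype ι] [Nonempty A] (f : ι → A → ℝ) :
    ⨅ v : ι → A, ((∑ i, f i (v i) : ℝ) : EReal) = ∑ i, ⨅ a, (f i a : EReal) := by
  have h1 := iSup_sum_pi fun i a => -f i a
  simp only [Finset.sum_neg_distrib, iSup_coe_neg] at h1
  rw [← neg_neg (⨅ v : ι → A, _), h1, ← ereal_sum_neg]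
  · simp
  · intro i _ hi
    rw [EReal.neg_eq_bot_iff] at hi
    obtain ⟨a⟩ := ‹Nonempty A›
    exact EReal.coe_ne_top (f i a) (top_le_iff.1 (hi ▸ iInf_le (fun a => (f i a : EReal)) a))

theorem infOf_eq_iInf {K : Set ℝ} (hK : K.Nonempty) : infOf K = ⨅ a : K, ((a : ℝ) : EReal) := by
  rw [infOf, if_pos hK, sInf_image']

theorem supOf_eq_iSup {K : Set ℝ} (hK : K.Nonempty) : supOf K = ⨆ a : K, ((a : ℝ) : EReal) := by
  rw [supOf, if_pos hK, sSup_image']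

/-! ### The dual domain as a box, and its extrema -/

namespace Setup

variable {n d : ℕ} {S : Setup n d}

theorem mem_dualDom_iff_lossDual (h : S.Standing) (hf : S.FiniteConj)
    {Z : Matrix (Fin n) (Fin d) ℝ} {α : EuclideanSpace ℝ (Fin n)} :
    α ∈ dualDom S.φ S.ψ Z ↔ ∀ i, α i ∈ S.lossDual :=
  (mem_dualDom_iff h.n_pos h.decomposable).trans
    ⟨fun hα => hα.1, fun hα => ⟨hα, fun j => hf j _⟩⟩

theorem Standing.αOld_mem_lossDual (h : S.Standing) (i : Fin n) : S.αOld i ∈ S.lossDual := by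
  change conj S.φ (-(S.αOld i)) ≠ ⊤
  rw [h.certificate_old.loss i]
  exact EReal.coe_ne_top _

theorem Standing.lossDual_nonempty (h : S.Standing) : S.lossDual.Nonempty :=
  ⟨_, h.αOld_mem_lossDual ⟨0, h.n_pos⟩⟩

/-- The dual domain as a type of families, if the conjugate components are finite. -/
def dualDomEquiv (h : S.Standing) (hf : S.FiniteConj) (Z : Matrix (Fin n) (Fin d) ℝ) :
    (Fin n → S.lossDual) ≃ dualDom S.φ S.ψ Z where
  toFun v := ⟨WithLp.toLp 2 fun i => (v i : ℝ), (mem_dualDom_iff_lossDual h hf).2 fun i => (v i).2⟩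
  invFun α i := ⟨α.1 i, (mem_dualDom_iff_lossDual h hf).1 α.2 i⟩
  left_inv _ := rfl
  right_inv _ := rfl

/-- Extremal value of `z a` over `a` in `-dom φ*`, where `o` is `max` or `min`. -/
def boxValue (S : Setup n d) (o : BinOp) (z : ℝ) : EReal :=
  o.eval (z * infOf S.lossDual) (z * supOf S.lossDual)

theorem Standing.boxValue_max (h : S.Standing) (z : ℝ) :
    S.boxValue .max z = ⨆ a : S.lossDual, ((z * (a : ℝ) : ℝ) : EReal) := by
  have := h.lossDual_nonempty.to_subtype
  rw [boxValue, BinOp.eval, infOf_eq_iInf h.lossDual_nonempty, supOf_eq_iSup h.lossDual_nonempty,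
    iSup_coe_mul]

theorem Standing.boxValue_min (h : S.Standing) (z : ℝ) :
    S.boxValue .min z = ⨅ a : S.lossDual, ((z * (a : ℝ) : ℝ) : EReal) := by
  have := h.lossDual_nonempty.to_subtype
  rw [boxValue, BinOp.eval, infOf_eq_iInf h.lossDual_nonempty, supOf_eq_iSup h.lossDual_nonempty,
    iInf_coe_mul]

theorem Standing.boxValue_max_ne_bot (h : S.Standing) (z : ℝ) : S.boxValue .max z ≠ ⊥ := by
  obtain ⟨a, ha⟩ := h.lossDual_nonempty
  rw [h.boxValue_max]
  exact ne_bot_of_le_ne_bot (EReal.coe_ne_bot _)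
    (le_iSup (fun a : S.lossDual => ((z * (a : ℝ) : ℝ) : EReal)) ⟨a, ha⟩)

theorem Standing.boxValue_min_ne_top (h : S.Standing) (z : ℝ) : S.boxValue .min z ≠ ⊤ := by
  obtain ⟨a, ha⟩ := h.lossDual_nonempty
  rw [h.boxValue_min]
  exact ne_top_of_le_ne_top (EReal.coe_ne_top _)
    (iInf_le (fun a : S.lossDual => ((z * (a : ℝ) : ℝ) : EReal)) ⟨a, ha⟩)

theorem boxValue_mul (S : Setup n d) {o : BinOp} (ho : o = .max ∨ o = .min) {c : ℝ}
    (hc : 0 ≤ c) (z : ℝ) : S.boxValue o (c * z) = c * S.boxValue o z := by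
  have hmono : Monotone fun x : EReal => (c : EReal) * x := fun a b hab =>
    mul_le_mul_of_nonneg_left hab (EReal.coe_nonneg.2 hc)
  rcases ho with rfl | rfl
  · simp only [boxValue, BinOp.eval, EReal.coe_mul, mul_assoc]
    exact (hmono.map_max).symm
  · simp only [boxValue, BinOp.eval, EReal.coe_mul, mul_assoc]
    exact (hmono.map_min).symm

theorem inv_mul_inner_col (Z : Matrix (Fin n) (Fin d) ℝ) (j : Fin d)
    (α : EuclideanSpace ℝ (Fin n)) :
    (n : ℝ)⁻¹ * inner ℝ (col Z j) α = ∑ i, (n : ℝ)⁻¹ * Z i j * α i := by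
  simp only [PiLp.inner_apply, col, RCLike.inner_apply, conj_trivial, Finset.mul_sum]
  exact Finset.sum_congr rfl fun i _ => by ring

/-- On the product domain a linear function separates, and its infimum is the sum of one-dimensional
infima. -/
theorem Standing.infCorr_eq (h : S.Standing) (hf : S.FiniteConj) (Z : Matrix (Fin n) (Fin d) ℝ)
    (j : Fin d) :
    infCorr S.φ S.ψ Z j = (((n : ℝ)⁻¹ : ℝ) : EReal) * ∑ i, S.boxValue .min (Z i j) := by
  have := h.lossDual_nonempty.to_subtype
  have hn : (0 : ℝ) ≤ (n : ℝ)⁻¹ := by positivity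
  rw [infCorr, iInf_subtype', ← (dualDomEquiv h hf Z).iInf_comp, ereal_mul_sum hn]
  simp only [inv_mul_inner_col, ← S.boxValue_mul (Or.inr rfl) hn]
  simp only [h.boxValue_min]
  exact iInf_sum_pi fun i (a : S.lossDual) => (n : ℝ)⁻¹ * Z i j * a

theorem Standing.supCorr_eq (h : S.Standing) (hf : S.FiniteConj) (Z : Matrix (Fin n) (Fin d) ℝ)
    (j : Fin d) :
    supCorr S.φ S.ψ Z j = (((n : ℝ)⁻¹ : ℝ) : EReal) * ∑ i, S.boxValue .max (Z i j) := by
  have := h.lossDual_nonempty.to_subtype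
  have hn : (0 : ℝ) ≤ (n : ℝ)⁻¹ := by positivity
  rw [supCorr, iSup_subtype', ← (dualDomEquiv h hf Z).iSup_comp, ereal_mul_sum hn]
  simp only [inv_mul_inner_col, ← S.boxValue_mul (Or.inl rfl) hn]
  simp only [h.boxValue_max]
  exact iSup_sum_pi fun i (a : S.lossDual) => (n : ℝ)⁻¹ * Z i j * a

/-- If the extrema for a column are finite, so is the contribution of each of its entries. -/
theorem Standing.boxValue_finite (h : S.Standing) (hf : S.FiniteConj)
    {Z : Matrix (Fin n) (Fin d) ℝ} {j : Fin d} (hinf : infCorr S.φ S.ψ Z j ≠ ⊥)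
    (hsup : supCorr S.φ S.ψ Z j ≠ ⊤) (i : Fin n) :
    S.boxValue .min (Z i j) ≠ ⊥ ∧ S.boxValue .max (Z i j) ≠ ⊤ := by
  have hn : (0 : ℝ) < (n : ℝ)⁻¹ := by have := h.n_pos; positivity
  rw [h.infCorr_eq hf] at hinf
  rw [h.supCorr_eq hf] at hsup
  constructor
  · intro hi
    apply hinf
    rw [← Finset.add_sum_erase _ _ (Finset.mem_univ i), hi, EReal.bot_add,
      EReal.coe_mul_bot_of_pos hn]
  · have : ∑ i, S.boxValue .max (Z i j) ≠ ⊤ := by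
      intro hs
      exact hsup (by rw [hs, EReal.coe_mul_top_of_pos hn])
    exact (ereal_sum_ne_top_iff fun k _ => h.boxValue_max_ne_bot _).1 this i (Finset.mem_univ i)

theorem Standing.infDual_eq (h : S.Standing) (hf : S.FiniteConj) (Z : Matrix (Fin n) (Fin d) ℝ)
    (i : Fin n) : infDual S.φ S.ψ Z i = infOf S.lossDual := by
  rw [infOf_eq_iInf h.lossDual_nonempty]
  refine le_antisymm (le_iInf fun a => ?_) (le_iInf₂ fun α hα => ?_)
  -- Any admissible value in coordinate `i` extends to a point of the dual domain, with the old α in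
  -- the other coordinates.
  · let v : Fin n → S.lossDual :=
      Function.update (fun k => ⟨S.αOld k, h.αOld_mem_lossDual k⟩) i a
    refine (iInf₂_le _ (dualDomEquiv h hf Z v).2).trans (le_of_eq ?_)
    simp [dualDomEquiv, v]
  · exact iInf_le (fun a : S.lossDual => ((a : ℝ) : EReal))
      ⟨α i, (mem_dualDom_iff_lossDual h hf).1 hα i⟩

theorem Standing.supDual_eq (h : S.Standing) (hf : S.FiniteConj) (Z : Matrix (Fin n) (Fin d) ℝ)
    (i : Fin n) : supDual S.φ S.ψ Z i = supOf S.lossDual := by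
  rw [supOf_eq_iSup h.lossDual_nonempty]
  refine le_antisymm (iSup₂_le fun α hα => ?_) (iSup_le fun a => ?_)
  · exact le_iSup (fun a : S.lossDual => ((a : ℝ) : EReal))
      ⟨α i, (mem_dualDom_iff_lossDual h hf).1 hα i⟩
  · let v : Fin n → S.lossDual :=
      Function.update (fun k => ⟨S.αOld k, h.αOld_mem_lossDual k⟩) i a
    refine le_trans (le_of_eq ?_) (le_iSup₂ (f := fun (β : EuclideanSpace ℝ (Fin n))
      (_ : β ∈ dualDom S.φ S.ψ Z) => ((β i : ℝ) : EReal)) _ (dualDomEquiv h hf Z v).2)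
    simp [dualDomEquiv, v]

theorem eval_boxExtremum (S : Setup n d) (s : Store) (l : List (Fin n × Fin d))
    (W : ℕ → ℕ → EReal) (o : BinOp) (p : Fin n × Fin d) :
    (boxExtremum o .xNew).eval (S.input s l) (entrySlots p) W =
        S.boxValue o (S.Znew p.1 p.2) ∧
      (boxExtremum o .xOld).eval (S.input s l) (entrySlots p) W =
        S.boxValue o (S.Zold p.1 p.2) := by
  simp [Expr.eval, boxExtremum, signedEntry, input, arrayOf, scalarOf, entrySlots,
    toArray_val, matrixOf_xNew, matrixOf_xOld, boxValue, Znew, Zold, signed]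
  exact ⟨rfl, rfl⟩

/-- The accumulated change turns the old extremum for a column into the new one. -/
theorem add_planned_box (h : S.Standing) (s : Store) {l : List (Fin n × Fin d)} (hl : l.Nodup)
    (hM : l.toFinset = S.M) {o : BinOp} {k : ℕ} {j : Fin d}
    (hk : planned (S.input s l) k j = sumAt (S.input s l) .col j
      (.op .sub (boxExtremum o .xNew) (boxExtremum o .xOld)))
    (hbot : ∀ i, S.boxValue o (S.Zold i j) ≠ ⊥) (htop : ∀ i, S.boxValue o (S.Zold i j) ≠ ⊤) :
    (((n : ℝ)⁻¹ : ℝ) : EReal) * ∑ i, S.boxValue o (S.Zold i j) +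
        (((n : ℝ)⁻¹ : ℝ) : EReal) * planned (S.input s l) k j =
      (((n : ℝ)⁻¹ : ℝ) : EReal) * ∑ i, S.boxValue o (S.Znew i j) := by
  have hn : (0 : ℝ) ≤ (n : ℝ)⁻¹ := by positivity
  rw [hk, S.sumAt_eq s hl hM, ← EReal.left_distrib_of_nonneg_of_ne_top (EReal.coe_nonneg.2 hn)
    (EReal.coe_ne_top _)]
  have hev : ∀ p : Fin n × Fin d, (Expr.op .sub (boxExtremum o .xNew)
      (boxExtremum o .xOld)).eval (S.input s l) (entrySlots p) (planned (S.input s l)) =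
      S.boxValue o (S.Znew p.1 p.2) - S.boxValue o (S.Zold p.1 p.2) := fun p => by
    rw [Expr.eval, (S.eval_boxExtremum s l _ o p).1, (S.eval_boxExtremum s l _ o p).2]
    rfl
  simp only [hev]
  congr 1
  refine (congrArg _ (sum_mem_snd S.M
    (fun p => S.boxValue o (S.Znew p.1 p.2) - S.boxValue o (S.Zold p.1 p.2)) j
    fun i hi => ?_)).trans ?_
  · have : S.Znew i j = S.Zold i j := by simp [Znew, Zold, signed, h.unmodified i j hi]
    simp only [this]
    -- For an unmodified entry a − a is 0 only because a is finite.
    exact EReal.sub_self (htop i) (hbot i)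
  · rw [← Finset.sum_add_distrib]
    refine Finset.sum_congr rfl fun i _ => ?_
    have hb := hbot i
    have ht := htop i
    simp only
    generalize S.boxValue o (S.Zold i j) = a at hb ht ⊢
    generalize S.boxValue o (S.Znew i j) = b
    -- With a finite, a + (b − a) = b holds for infinite b as well, so the new extremum may be
    -- infinite.
    lift a to ℝ using ⟨ht, hb⟩
    induction b with
    | bot => simp
    | top => simp
    | coe b => norm_cast; ring

/-! ### Correctness of the queries -/

section Queries

variable {s : Store} {l : List (Fin n × Fin d)} {ρ : Slot → ℕ}

theorem eval_infCorrExpr (h : S.Standing) (hl : l.Nodup) (hM : l.toFinset = S.M) {j : Fin d}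
    (hj : ρ .target = j) (hs : S.EnoughW s .smooth j) :
    (infCorrExpr s).eval (S.input s l) ρ (planned (S.input s l)) =
      infCorr S.φ S.ψ S.Znew j := by
  cases s with
  | withNewExtrema => simp [infCorrExpr, Expr.eval, hj, input, arrayOf, toArray_val]
  | oldOnly =>
    obtain ⟨hf, hinf, hsup⟩ := hs
    have hA : (S.input .oldOnly l).array .oldInfCorr (j : ℕ) = infCorr S.φ S.ψ S.Zold j := by
      simp [input, arrayOf, toArray_val]
    have hn : (S.input .oldOnly l).scalar .size = ((n : ℝ) : EReal) := rfl
    simp only [infCorrExpr, Expr.eval, BinOp.eval, hj, hA, hn, ← EReal.coe_inv, h.infCorr_eq hf]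
    exact add_planned_box h .oldOnly hl hM (planned_eq _ _).2.2.2.2.1
      (fun i => (h.boxValue_finite hf hinf hsup i).1) fun i => h.boxValue_min_ne_top _

theorem eval_supCorrExpr (h : S.Standing) (hl : l.Nodup) (hM : l.toFinset = S.M) {j : Fin d}
    (hj : ρ .target = j) (hs : S.EnoughW s .smooth j) :
    (supCorrExpr s).eval (S.input s l) ρ (planned (S.input s l)) =
      supCorr S.φ S.ψ S.Znew j := by
  cases s with
  | withNewExtrema => simp [supCorrExpr, Expr.eval, hj, input, arrayOf, toArray_val]
  | oldOnly =>
    obtain ⟨hf, hinf, hsup⟩ := hs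
    have hA : (S.input .oldOnly l).array .oldSupCorr (j : ℕ) = supCorr S.φ S.ψ S.Zold j := by
      simp [input, arrayOf, toArray_val]
    have hn : (S.input .oldOnly l).scalar .size = ((n : ℝ) : EReal) := rfl
    simp only [supCorrExpr, Expr.eval, BinOp.eval, hj, hA, hn, ← EReal.coe_inv, h.supCorr_eq hf]
    exact add_planned_box h .oldOnly hl hM (planned_eq _ _).2.2.2.2.2.1
      (fun i => h.boxValue_max_ne_bot _) fun i => (h.boxValue_finite hf hinf hsup i).2

theorem eval_infDualExpr (h : S.Standing) {i : Fin n} (hi : ρ .target = i)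
    (hs : S.Enoughα s .smooth) (W : ℕ → ℕ → EReal) :
    (infDualExpr s).eval (S.input s l) ρ W = infDual S.φ S.ψ S.Znew i := by
  cases s with
  | withNewExtrema => simp [infDualExpr, Expr.eval, hi, input, arrayOf, toArray_val]
  | oldOnly => rw [h.infDual_eq hs]; rfl

theorem eval_supDualExpr (h : S.Standing) {i : Fin n} (hi : ρ .target = i)
    (hs : S.Enoughα s .smooth) (W : ℕ → ℕ → EReal) :
    (supDualExpr s).eval (S.input s l) ρ W = supDual S.φ S.ψ S.Znew i := by
  cases s with
  | withNewExtrema => simp [supDualExpr, Expr.eval, hi, input, arrayOf, toArray_val]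
  | oldOnly => rw [h.supDual_eq hs]; rfl

theorem eval_radiusExpr (h : S.Standing) (hl : l.Nodup) (hM : l.toFinset = S.M)
    (ho : ρ .origin = 0) :
    (radiusExpr .gamma).eval (S.input s l) ρ (planned (S.input s l)) =
        esqrt (((2 * S.γ⁻¹ : ℝ) : EReal) * S.gap) ∧
      (radiusExpr .lambda).eval (S.input s l) ρ (planned (S.input s l)) =
        esqrt (((2 * S.lam⁻¹ : ℝ) : EReal) * S.gap) ∧
      dualRadiusExpr.eval (S.input s l) ρ (planned (S.input s l)) =
        esqrt (((2 * (n : ℝ) * S.γ⁻¹ : ℝ) : EReal) * S.gap) := by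
  have h2 : ((2 : ℕ) : EReal) = ((2 : ℝ) : EReal) := rfl
  simp only [radiusExpr, dualRadiusExpr, Expr.eval, BinOp.eval, eval_gapExpr h s hl hM ho, h2]
  simp only [input, scalarOf, ← EReal.coe_inv, ← EReal.coe_mul, true_and]

theorem eval_colExprs (h : S.Standing) (hl : l.Nodup) (hM : l.toFinset = S.M) {j : Fin d}
    (hj : ρ .target = j) :
    colCorrExpr.eval (S.input s l) ρ (planned (S.input s l)) =
        (((n : ℝ)⁻¹ * inner ℝ (col S.Znew j) S.αOld : ℝ) : EReal) ∧
      colNormExpr.eval (S.input s l) ρ (planned (S.input s l)) =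
        ((‖col S.Xnew j‖ : ℝ) : EReal) := by
  have hA : (S.input s l).array .colCorr (j : ℕ) =
      ((inner ℝ (col S.Zold j) S.αOld : ℝ) : EReal) := by
    simp [input, arrayOf, toArray_val]
  have hB : (S.input s l).array .colNorm (j : ℕ) = ((‖col S.Xold j‖ : ℝ) : EReal) := by
    simp [input, arrayOf, toArray_val]
  have hn : (S.input s l).scalar .size = ((n : ℝ) : EReal) := rfl
  simp only [colCorrExpr, colNormExpr, Expr.eval, BinOp.eval, hj, hA, hB, hn,
    planned_corr h s hl hM j, ← EReal.coe_inv, ← EReal.coe_mul,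
    true_and]
  rw [EReal.coe_mul, planned_colNorm h s hl hM j]

theorem eval_rowExprs (h : S.Standing) (hl : l.Nodup) (hM : l.toFinset = S.M) {i : Fin n}
    (hi : ρ .target = i) :
    rowScoreExpr.eval (S.input s l) ρ (planned (S.input s l)) =
        ((inner ℝ (row S.Znew i) S.wOld : ℝ) : EReal) ∧
      rowNormExpr.eval (S.input s l) ρ (planned (S.input s l)) =
        ((‖row S.Xnew i‖ : ℝ) : EReal) := by
  have hA : (S.input s l).array .rowScore (i : ℕ) =
      ((inner ℝ (row S.Zold i) S.wOld : ℝ) : EReal) := by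
    simp [input, arrayOf, toArray_val]
  have hB : (S.input s l).array .rowNorm (i : ℕ) = ((‖row S.Xold i‖ : ℝ) : EReal) := by
    simp [input, arrayOf, toArray_val]
  simp only [rowScoreExpr, rowNormExpr, Expr.eval, BinOp.eval, hi, hA, hB,
    planned_score h s hl hM i, planned_rowNorm h s hl hM i, true_and]

theorem eval_boundsW_smooth (h : S.Standing) (hl : l.Nodup) (hM : l.toFinset = S.M) {j : Fin d}
    (hj : ρ .target = j) (ho : ρ .origin = 0) (hs : S.EnoughW s .smooth j) :
    (LDwExpr s).eval (S.input s l) ρ (planned (S.input s l)) = S.LDw j ∧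
      (UDwExpr s).eval (S.input s l) ρ (planned (S.input s l)) = S.UDw j := by
  simp only [LDwExpr, UDwExpr, Expr.eval, BinOp.eval, eval_infCorrExpr h hl hM hj hs,
    eval_supCorrExpr h hl hM hj hs, (eval_colExprs h hl hM hj).1, (eval_colExprs h hl hM hj).2,
    (eval_radiusExpr h hl hM ho).1, hj]
  simp only [input, funcOf, toArray_val]
  exact ⟨rfl, rfl⟩

theorem eval_boundsα_smooth (h : S.Standing) (hl : l.Nodup) (hM : l.toFinset = S.M) {i : Fin n}
    (hi : ρ .target = i) (ho : ρ .origin = 0) (hs : S.Enoughα s .smooth) :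
    (LDαExpr s).eval (S.input s l) ρ (planned (S.input s l)) = S.LDα i ∧
      (UDαExpr s).eval (S.input s l) ρ (planned (S.input s l)) = S.UDα i := by
  simp only [LDαExpr, UDαExpr, Expr.eval, BinOp.eval, eval_infDualExpr h hi hs,
    eval_supDualExpr h hi hs, (eval_radiusExpr h hl hM ho).2.2, hi]
  simp only [input, arrayOf, toArray_val]
  exact ⟨rfl, rfl⟩

theorem eval_boundsW_strong (h : S.Standing) (hl : l.Nodup) (hM : l.toFinset = S.M) {j : Fin d}
    (hj : ρ .target = j) (ho : ρ .origin = 0) :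
    LPwExpr.eval (S.input s l) ρ (planned (S.input s l)) = S.LPw j ∧
      UPwExpr.eval (S.input s l) ρ (planned (S.input s l)) = S.UPw j := by
  simp only [LPwExpr, UPwExpr, Expr.eval, BinOp.eval, (eval_radiusExpr h hl hM ho).2.1, hj]
  simp only [input, arrayOf, toArray_val]
  exact ⟨rfl, rfl⟩

theorem eval_boundsα_strong (h : S.Standing) (hl : l.Nodup) (hM : l.toFinset = S.M) {i : Fin n}
    (hi : ρ .target = i) (ho : ρ .origin = 0) :
    LPαExpr.eval (S.input s l) ρ (planned (S.input s l)) = S.LPα i ∧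
      UPαExpr.eval (S.input s l) ρ (planned (S.input s l)) = S.UPα i := by
  simp only [LPαExpr, UPαExpr, Expr.eval, BinOp.eval, (eval_rowExprs h hl hM hi).1,
    (eval_rowExprs h hl hM hi).2, (eval_radiusExpr h hl hM ho).2.1]
  exact ⟨rfl, rfl⟩

theorem eval_boundsW (h : S.Standing) (hl : l.Nodup) (hM : l.toFinset = S.M) {j : Fin d}
    (hj : ρ .target = j) (ho : ρ .origin = 0) {c : Case} (hs : S.EnoughW s c j) :
    (lowerWExpr s c).eval (S.input s l) ρ (planned (S.input s l)) = S.lowerW c j ∧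
      (upperWExpr s c).eval (S.input s l) ρ (planned (S.input s l)) = S.upperW c j := by
  have hP := eval_boundsW_strong (s := s) h hl hM hj ho
  cases c with
  | smooth => exact eval_boundsW_smooth h hl hM hj ho hs
  | strong => exact hP
  | both =>
    have hD := eval_boundsW_smooth (s := s) h hl hM hj ho (by cases s <;> exact hs)
    exact ⟨congrArg₂ max hP.1 hD.1, congrArg₂ min hP.2 hD.2⟩

theorem eval_boundsα (h : S.Standing) (hl : l.Nodup) (hM : l.toFinset = S.M) {i : Fin n}
    (hi : ρ .target = i) (ho : ρ .origin = 0) {c : Case} (hs : S.Enoughα s c) :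
    (lowerαExpr s c).eval (S.input s l) ρ (planned (S.input s l)) = S.lowerα c i ∧
      (upperαExpr s c).eval (S.input s l) ρ (planned (S.input s l)) = S.upperα c i := by
  have hP := eval_boundsα_strong (s := s) h hl hM hi ho
  cases c with
  | smooth => exact eval_boundsα_smooth h hl hM hi ho hs
  | strong => exact hP
  | both =>
    have hD := eval_boundsα_smooth (s := s) h hl hM hi ho (by cases s <;> exact hs)
    exact ⟨congrArg₂ max hP.1 hD.1, congrArg₂ min hP.2 hD.2⟩

end Queries

end Setup

end ERM

end

/-! ### The bounds and their evaluation -/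

theorem theorem1 :
    -- the bounds, in each of the three cases
    (∀ (n d : ℕ) (S : ERM.Setup n d), S.Standing →
      S.gap = ((ERM.primal S.φ S.ψ S.Znew S.wOld : ℝ) : EReal)
          - ERM.dual S.φ S.ψ S.Znew S.αOld ∧
      ∀ c : ERM.Case, S.Has c →
        ∀ (w : EuclideanSpace ℝ (Fin d)) (α : EuclideanSpace ℝ (Fin n)), S.NewOptimal w α →
          (∀ j, S.lowerW c j ≤ ((w j : ℝ) : EReal) ∧ ((w j : ℝ) : EReal) ≤ S.upperW c j) ∧
          (∀ i, S.lowerα c i ≤ ((α i : ℝ) : EReal) ∧ ((α i : ℝ) : EReal) ≤ S.upperα c i)) ∧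
    -- their evaluation: a first phase of `O(|M|)` steps, then `O(1)` steps for each index;
    -- the programs and the constant depend on nothing but the kind of store and the case
    (∃ (pre : ERM.Store → ERM.Cmd) (queryW queryα : ERM.Store → ERM.Case → ERM.Cmd) (C : ℕ),
      ∀ (n d : ℕ) (S : ERM.Setup n d), S.Standing →
      ∀ l : List (Fin n × Fin d), l.Nodup → l.toFinset = S.M →
      ∀ s : ERM.Store,
        (ERM.exec (S.input s l) (pre s) ERM.Memory.initial).2 ≤ C * (S.M.card + 1) ∧
        ∀ c : ERM.Case, S.Has c →
          (∀ j : Fin d, S.EnoughW s c j →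
            ERM.Answers (S.input s l) (queryW s c)
              (ERM.exec (S.input s l) (pre s) ERM.Memory.initial).1 j
              (S.lowerW c j) (S.upperW c j) C) ∧
          (S.Enoughα s c → ∀ i : Fin n,
            ERM.Answers (S.input s l) (queryα s c)
              (ERM.exec (S.input s l) (pre s) ERM.Memory.initial).1 i
              (S.lowerα c i) (S.upperα c i) C)) := by
  -- The first phase is the same for every store and fills all ten arrays; the box corrections are
  -- read only if the new extrema are not stored. The constant 200 exceeds both the cost factor of
  -- the plan and the cost of each pair of query expressions.
  refine ⟨fun n d S h => ⟨h.gap_eq, fun c hc w α ho => h.bounds hc ho⟩,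
    fun _ => ERM.accumulateAll ERM.plan,
    fun s c => .seq ((ERM.lowerWExpr s c).compile 0) ((ERM.upperWExpr s c).compile 1),
    fun s c => .seq ((ERM.lowerαExpr s c).compile 0) ((ERM.upperαExpr s c).compile 1),
    200, fun n d S h l hl hM s => ?_⟩
  obtain ⟨h4, hW, hT⟩ :=
    ERM.exec_accumulateAll (S.input s l) ERM.plan_avoids ERM.Memory.initial rfl rfl
  refine ⟨hT.trans ?_, fun c _ => ⟨fun j hs => ?_, fun hs i => ?_⟩⟩
  · have hcard : (S.input s l).count = S.M.card := by
      rw [← hM, List.toFinset_card_of_nodup hl]; rfl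
    rw [hcard]
    exact Nat.mul_le_mul_right _ ERM.cost_plan_le
  · refine ERM.answers_compile _ _ _ _ h4 _ (fun ρ hj ho => ?_) (fun ρ hj ho => ?_)
      (ERM.cost_queries_le s c).1
    · rw [hW]; exact (ERM.Setup.eval_boundsW h hl hM hj ho hs).1
    · rw [hW]; exact (ERM.Setup.eval_boundsW h hl hM hj ho hs).2
  · refine ERM.answers_compile _ _ _ _ h4 _ (fun ρ hi ho => ?_) (fun ρ hi ho => ?_)
      (ERM.cost_queries_le s c).2
    · rw [hW]; exact (ERM.Setup.eval_boundsα h hl hM hi ho hs).1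
    · rw [hW]; exact (ERM.Setup.eval_boundsα h hl hM hi ho hs).2
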